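/- Let $n\ge 1$, let $\mathbb{B}_n$ be the open unit ball of $\mathbb{C}^n$, $V$ (or $|\cdot|$) Lebesgue measure, and $\langle z,w\rangle=\sum_i z_i\overline{w_i}$. The Bergman projection is $$Pf(z)=\frac{n!}{\pi^n}\int_{\mathbb{B}_n}\frac{f(w)}{(1-\langle z,w\rangle)^{n+1}}\,dV(w),\qquad z\in\mathbb{B}_n,$$ and $[g,P]f:=g\,Pf-P(gf)$. *Dyadic tents.* Fix $\theta_0>0$, put $\delta=e^{-2\theta_0}$ and $\rho(\zeta,\xi)=|1-\langle \zeta,\xi\rangle|$ on the sphere $\partial\mathbb{B}_n$. Fix finitely many dyadic systems $\mathcal{Q}_1,\dots,\mathcal{Q}_N$ on $\partial\mathbb{B}_n$. Each consists, for every $k=0,1,2,\dots$, of finitely many Borel sets $Q^k_j$ partitioning $\partial\mathbb{B}_n$ (for $k=0$ only the whole sphere), such that for $k\le l$ every $Q^l_i$ is either contained in or disjoint from $Q^k_j$, and such that each $Q^k_j$ has a reference point $x^k_j$ for which $Q^k_j$ contains the $\rho$-ball with center $x^k_j$ and radius $a\delta^k$ and is contained in the one with radius $A\delta^k$, with $a,A>0$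 independent of $k,j$. Together they approximate all balls: there is $A'>0$ such that every $\rho$-ball of radius $r>0$ with $A'r\le 1$ is contained in some $Q^k_j$ of one of the systems with $\delta^k\le A'r$. Let $d_\beta(z,0)=\frac12\log\frac{1+|z|}{1-|z|}$ be the Bergman distance to the origin, and let $P_k$ be the radial projection onto the sphere $\{d_\beta(z,0)=k\theta_0\}$. For each system define the kubes $$K^k_j=\{z\in\mathbb{B}_n:\ k\theta_0\le d_\beta(z,0)<(k+1)\theta_0,\ P_kz\in P_k(Q^k_j)\};$$ call $K^{k+1}_i$ a child of $K^k_j$ if $P_k(x^{k+1}_i)\in K^k_j$, and let the dyadic Carleson tent $\widehat K$ be the union of all descendants of $K$, including $K$. Let $\mathcal{D}$ be the collection of all kubes of all the systems. *Exponential oscillation.* For $1\le r<\infty$, a locally integrable $b:\mathbb{B}_n\to\mathbb{C}$ belongs to $\operatorname{osc}_{(\exp L)^r}$ if for some $c>0$ $$\sup_{K\in\mathcal{D}}\frac1{|\widehat K|}\int_{\widehat K}\exp\left(\left|\frac{b-\langle b\rangle_{\widehat K}}{c}\right|^r\right)dV<\infty,\qquad \langle b\rangle_{\widehat K}=\frac1{|\widehat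 K|}\int_{\widehat K}b\,dV,$$ and $\|b\|_{\operatorname{osc}_{(\exp L)^r}}$ is the infimum of the $c>0$ for which $$\sup_{K\in\mathcal{D}}\frac1{|\widehat K|}\int_{\widehat K}\left(\exp\left(\left|\frac{b-\langle b\rangle_{\widehat K}}{c}\right|^r\right)-1\right)dV\le 1.$$ **Theorem.** Let $\varepsilon\in(0,1]$. There is a constant $C>0$, depending only on $n$, $\varepsilon$ and the fixed dyadic structure, such that for every $b\in\operatorname{osc}_{(\exp L)^{1/\varepsilon}}$, every bounded measurable function $f$ with compact support in $\mathbb{B}_n$, and every $\lambda>0$, $$\left|\left\{z\in\mathbb{B}_n:\ |[\bar b,P]f(z)|>\lambda\right\}\right|\le C\,\|b\|_{\operatorname{osc}_{(\exp L)^{1/\varepsilon}}}\int_{\mathbb{B}_n}\frac{|f(z)|}{\lambda}\left(1+\log^+\left(\frac{|f(z)|\,\|b\|_{\operatorname{osc}_{(\exp L)^{1/\varepsilon}}}}{\lambda}\right)\right)^{\varepsilon}dV(z),$$ where $\log^+t=\max\{0,\log t\}$ and $\log^+0=0$. -/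

import Mathlib

open MeasureTheory Metric

namespace BergmanCommutator

/-- The space `ℂⁿ` with its Euclidean norm. Its `volume` is Lebesgue measure on `ℝ²ⁿ`, and
`inner ℂ w z = ∑ zᵢ * conj wᵢ` is the Hermitian product `⟨z, w⟩`, linear in `z`. -/
abbrev Cn (n : ℕ) : Type := EuclideanSpace ℂ (Fin n)

/-- The open unit ball of `ℂⁿ`. -/
def unitBall (n : ℕ) : Set (Cn n) := ball 0 1

/-- The unit sphere, the boundary of the unit ball. -/
def unitSphere (n : ℕ) : Set (Cn n) := sphere 0 1

/-! ### The Bergman projection and its commutators -/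

/-- The Bergman projection,
`P f (z) = (n! / πⁿ) ∫_{𝔹ₙ} f(w) / (1 - ⟨z, w⟩)ⁿ⁺¹ dV(w)`. -/
noncomputable def bergmanProj (n : ℕ) (f : Cn n → ℂ) (z : Cn n) : ℂ :=
  ((n.factorial : ℂ) / (Real.pi : ℂ) ^ n) *
    ∫ w in unitBall n, f w / (1 - inner ℂ w z) ^ (n + 1)

/-- The commutator `[g, P] f = g · P f - P (g · f)`. -/
noncomputable def commutator (n : ℕ) (g f : Cn n → ℂ) (z : Cn n) : ℂ :=
  g z * bergmanProj n f z - bergmanProj n (fun w => g w * f w) z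

/-! ### Dyadic systems on the sphere -/

/-- The ball `{ζ ∈ ∂𝔹ₙ : |1 - ⟨x, ζ⟩| < r}` of the quasi-metric `ρ(x, ζ) = |1 - ⟨x, ζ⟩|`. -/
def quasiBall {n : ℕ} (x : Cn n) (r : ℝ) : Set (Cn n) :=
  {ζ | ζ ∈ unitSphere n ∧ ‖1 - inner ℂ ζ x‖ < r}

/-- A dyadic system of Borel sets `Q_j^k` on the unit sphere, the sets of generation `k` having
scale `δ ^ k`, with reference points (`center`). Generation `0` consists of the whole sphere. -/
structure SphereDyadicSystem (n : ℕ) (δ : ℝ) where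
  /-- the number of sets of generation `k` -/
  card : ℕ → ℕ
  /-- the set `Q_j^k` -/
  cube : (k : ℕ) → Fin (card k) → Set (Cn n)
  /-- the reference point of `Q_j^k` -/
  center : (k : ℕ) → Fin (card k) → Cn n
  measurableSet_cube : ∀ k j, MeasurableSet (cube k j)
  center_mem : ∀ k j, center k j ∈ unitSphere n
  cube_zero : ∀ j, cube 0 j = unitSphere n
  iUnion_cube : ∀ k, ⋃ j, cube k j = unitSphere n
  disjoint_cube : ∀ k i j, i ≠ j → Disjoint (cube k i) (cube k j)
  nested : ∀ k l, k ≤ l → ∀ i j, cube l j ⊆ cube k i ∨ Disjoint (cube l j) (cube k i)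
  comparable : ∃ a A : ℝ, 0 < a ∧ 0 < A ∧ ∀ k j,
    quasiBall (center k j) (a * δ ^ k) ⊆ cube k j ∧
      cube k j ⊆ quasiBall (center k j) (A * δ ^ k)

/-- Finitely many dyadic systems on the unit sphere, of ratio `δ = exp (-2 θ₀)`, that together
approximate the balls of the quasi-metric: every small ball lies in a dyadic set of comparable
scale that belongs to one of the systems. -/
structure DyadicFamily (n : ℕ) (θ₀ : ℝ) where
  /-- the number of systems -/
  N : ℕ
  /-- the systems `𝒬_1, …, 𝒬_N` -/
  system : Fin N → SphereDyadicSystem n (Real.exp (-2 * θ₀))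
  approx : ∃ A : ℝ, 0 < A ∧ ∀ ζ ∈ unitSphere n, ∀ r : ℝ, 0 < r → A * r ≤ 1 →
    ∃ (ℓ : Fin N) (k : ℕ) (j : Fin ((system ℓ).card k)),
      quasiBall ζ r ⊆ (system ℓ).cube k j ∧ Real.exp (-2 * θ₀) ^ k ≤ A * r

/-! ### Kubes and dyadic Carleson tents in the ball -/

/-- The Bergman distance `d_β(z, 0)` of a point of the unit ball to the origin. -/
noncomputable def bergmanDistZero {n : ℕ} (z : Cn n) : ℝ :=
  1 / 2 * Real.log ((1 + ‖z‖) / (1 - ‖z‖))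

/-- The radial projection of `z` onto the Bergman sphere `{z : d_β(z, 0) = s}`, which is the
Euclidean sphere of radius `tanh s`. -/
noncomputable def radialProj {n : ℕ} (s : ℝ) (z : Cn n) : Cn n :=
  (Real.tanh s / ‖z‖) • z

namespace SphereDyadicSystem

variable {n : ℕ} {δ : ℝ}

/-- The indices `(k, j)` of the kubes of a dyadic system. -/
abbrev Kube (Q : SphereDyadicSystem n δ) : Type := (k : ℕ) × Fin (Q.card k)

/-- The kube `K_j^k`: the points `z` of the unit ball with `k θ₀ ≤ d_β(z, 0) < (k + 1) θ₀` whose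
projection `P_k z` to the Bergman sphere of radius `k θ₀` lies in `P_k (Q_j^k)`. For `k = 0` this
is the Bergman ball `{z : d_β(z, 0) < θ₀}`. -/
def kubeSet (Q : SphereDyadicSystem n δ) (θ₀ : ℝ) (K : Q.Kube) : Set (Cn n) :=
  {z | z ∈ unitBall n ∧ K.1 * θ₀ ≤ bergmanDistZero z ∧ bergmanDistZero z < (K.1 + 1) * θ₀ ∧
    radialProj (K.1 * θ₀) z ∈ radialProj (K.1 * θ₀) '' Q.cube K.1 K.2}

/-- The tree structure: `J` is a child of `K` if it belongs to the next generation and the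
projection of its center to the Bergman sphere of the generation of `K` lies in `K`. -/
def IsChild (Q : SphereDyadicSystem n δ) (θ₀ : ℝ) (J K : Q.Kube) : Prop :=
  J.1 = K.1 + 1 ∧ radialProj (K.1 * θ₀) (Q.center J.1 J.2) ∈ Q.kubeSet θ₀ K

/-- The dyadic Carleson tent: the union of all descendants of a kube (itself included). -/
def tent (Q : SphereDyadicSystem n δ) (θ₀ : ℝ) (K : Q.Kube) : Set (Cn n) :=
  {z | ∃ J : Q.Kube, Relation.ReflTransGen (Q.IsChild θ₀) J K ∧ z ∈ Q.kubeSet θ₀ J}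

end SphereDyadicSystem

/-! ### Exponential oscillation spaces -/

variable {n : ℕ} {θ₀ : ℝ}

/-- The supremum over all dyadic Carleson tents `T` (of all the systems) of the averages
`|T|⁻¹ ∫_T exp ((|b - ⟨b⟩_T| / c) ^ r) dV`, where `⟨b⟩_T` is the mean of `b` over `T`. If `b` is
not integrable on some `T`, the supremum is infinite, since so is the average over `T`. -/
noncomputable def expOscSup (D : DyadicFamily n θ₀) (b : Cn n → ℂ) (r c : ℝ) : ENNReal :=
  ⨆ (ℓ : Fin D.N) (K : (D.system ℓ).Kube),
    (volume ((D.system ℓ).tent θ₀ K))⁻¹ *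
      ∫⁻ w in (D.system ℓ).tent θ₀ K,
        ENNReal.ofReal (Real.exp ((‖b w - ⨍ u in (D.system ℓ).tent θ₀ K, b u‖ / c) ^ r))

/-- The space `osc_{(exp L)^r}`. -/
def MemOsc (D : DyadicFamily n θ₀) (r : ℝ) (b : Cn n → ℂ) : Prop :=
  LocallyIntegrableOn b (unitBall n) ∧ ∃ c : ℝ, 0 < c ∧ expOscSup D b r c < ⊤

/-- The (semi)norm of `osc_{(exp L)^r}`, of Luxemburg type for the Young function
`exp (t ^ r) - 1`: the infimum of the `c > 0` for which all averages of
`exp ((|b - ⟨b⟩_T| / c) ^ r) - 1` are at most `1`. -/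
noncomputable def oscNorm (D : DyadicFamily n θ₀) (r : ℝ) (b : Cn n → ℂ) : ℝ :=
  sInf {c : ℝ | 0 < c ∧ expOscSup D b r c ≤ 2}

end BergmanCommutator

/-!
Write `β_K = |b - ⟨b⟩_T| / c`, where `T` is the tent of `K` and `c` the oscillation norm of `b`.
Any two points `z`, `w` of the ball lie in a common dyadic tent of volume at most a multiple of
`|1 - ⟨z, w⟩| ^ (n + 1)`, and `|b(z) - b(w)| ≤ c (1 + β_K(z)) (1 + β_K(w))` on it. The commutator
is therefore at most a multiple of `c` times the sum over all systems of the sparse operator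
`∑_K 1_T(z) (1 + β_K(z)) |T|⁻¹ ∫_T (1 + β_K) |f|`.

Let `F = (c |f| / λ) (1 + log⁺ (c |f| / λ)) ^ ε`. The tents on which `F` has average above `1`
have a union of measure at most a multiple of `∫ F`, which disposes of them. On any other tent,
Young's inequality between `t (1 + log⁺ t) ^ ε` and `exp (s ^ (1 / ε))`, with a parameter chosen
according to the average `⟨F⟩_T`, bounds the average of `(1 + β_K) c |f| / λ` by a multiple of
`⟨F⟩_T ^ (3 / 4)`. The square of the sum over these tents is then integrated: the generations
below a tent occupy a geometrically small part of it, so that exponential weights in the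
generation make the terms almost orthogonal, and the integral is at most a multiple of
`∑ |T| ⟨F⟩_T ^ (3 / 2)`. As `3 / 2 > 1`, the Carleson embedding theorem bounds this by a multiple
of `∫ F`.

By Fatou's lemma the infimum in the definition of the norm is attained unless it is `0`; in that
case `b` is constant almost everywhere and the commutator vanishes.
-/

namespace BergmanCommutator

open scoped ENNReal

/-! ### Volumes of dyadic Carleson tents -/

section AnisotropicDilation

variable {E : Type*} [NormedAddCommGroup E] [InnerProductSpace ℂ E]

/-- The linear map multiplying the unit vector `x` by `a ^ 2` and its orthogonal complement by
`a`. It is written as `a` times a transvection because Mathlib knows the determinant of those. -/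
noncomputable def anisotropicDilation (a : ℂ) (x : E) : E →ₗ[ℂ] E :=
  a • LinearMap.transvection ((a - 1) • (innerSL ℂ x).toLinearMap) x

theorem anisotropicDilation_add_smul {x w : E} (hx : ‖x‖ = 1) (hw : inner ℂ x w = 0) (a s : ℂ) :
    anisotropicDilation a x (w + s • x) = a • w + (a ^ 2 * s) • x := by
  have hφ : inner ℂ x (w + s • x) = s := by
    simp [hw, inner_self_eq_norm_sq_to_K, hx]
  simp only [anisotropicDilation, LinearMap.smul_apply, LinearMap.transvection.apply,
    ContinuousLinearMap.coe_coe, innerSL_apply_apply, hφ]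
  match_scalars
  · ring
  · simp only [smul_eq_mul]; ring

theorem det_anisotropicDilation [FiniteDimensional ℂ E] {x : E} (hx : ‖x‖ = 1) (a : ℂ) :
    LinearMap.det (anisotropicDilation a x) = a ^ (Module.finrank ℂ E + 1) := by
  rw [anisotropicDilation, LinearMap.det_smul, LinearMap.transvection.det]
  simp [hx, pow_succ]

theorem norm_sq_eq_add_of_inner_eq_zero {x w : E} (hx : ‖x‖ = 1) (hw : inner ℂ x w = 0) (s : ℂ) :
    ‖w + s • x‖ ^ 2 = ‖w‖ ^ 2 + ‖s‖ ^ 2 := by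
  have h := norm_add_sq_eq_norm_sq_add_norm_sq_of_inner_eq_zero (𝕜 := ℂ) w (s • x) (by
    rw [inner_smul_right, inner_eq_zero_symm.1 hw, mul_zero])
  rw [norm_smul, hx, mul_one] at h
  linarith

theorem exists_orthogonal_add_smul {x : E} (hx : ‖x‖ = 1) (z : E) :
    ∃ w : E, inner ℂ x w = 0 ∧ z = w + (inner ℂ x z) • x :=
  ⟨z - (inner ℂ x z) • x, by simp [hx], by simp⟩

/-- The part of the unit ball where `|1 - ⟨z, x⟩| < R` has size `R` in the direction of `x` and,
by Pythagoras, `√R` orthogonally to it. -/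
theorem subset_image_anisotropicDilation {x : E} (hx : ‖x‖ = 1) {R : ℝ} (hR : 0 < R) :
    {z : E | ‖z‖ < 1 ∧ ‖1 - inner ℂ x z‖ < R} ⊆
      (x + ·) '' (anisotropicDilation (Real.sqrt R) x '' ball 0 3) := by
  rintro z ⟨hz, hzR⟩
  obtain ⟨w, hxw, hzw⟩ := exists_orthogonal_add_smul hx z
  set p : ℂ := inner ℂ x z
  have hsq : 0 < Real.sqrt R := Real.sqrt_pos.2 hR
  have hw : ‖w‖ ^ 2 ≤ 2 * R := by
    have hpyth := norm_sq_eq_add_of_inner_eq_zero hx hxw p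
    rw [← hzw] at hpyth
    have hp : 1 - ‖p‖ < R := by
      simpa using (norm_sub_norm_le 1 p).trans_lt hzR
    nlinarith [norm_nonneg z, sq_nonneg (1 - ‖p‖)]
  set a : ℂ := (Real.sqrt R : ℂ)
  have ha : a ≠ 0 := by simp [a, hsq.ne']
  have hna : ‖a‖ = Real.sqrt R := by simp [a]
  have hw' : ‖a⁻¹ • w‖ ≤ 3 / 2 := by
    rw [norm_smul, norm_inv, hna, inv_mul_le_iff₀ hsq]
    refine abs_le_of_sq_le_sq' ?_ (by positivity) |>.2
    rw [mul_pow, Real.sq_sqrt hR.le]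
    linarith
  have hp' : ‖(a⁻¹ ^ 2 * (p - 1)) • x‖ < 1 := by
    rw [norm_smul, hx, mul_one, norm_mul, norm_pow, norm_inv, hna, inv_pow, Real.sq_sqrt hR.le,
      inv_mul_lt_iff₀ hR, mul_one, norm_sub_rev]
    exact hzR
  refine ⟨z - x, ⟨a⁻¹ • w + (a⁻¹ ^ 2 * (p - 1)) • x, ?_, ?_⟩, add_sub_cancel x z⟩
  · rw [mem_ball_zero_iff]
    linarith [norm_add_le (a⁻¹ • w) ((a⁻¹ ^ 2 * (p - 1)) • x)]
  · rw [anisotropicDilation_add_smul hx (by rw [inner_smul_right, hxw, mul_zero]),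
      smul_inv_smul₀ ha, ← mul_assoc, ← mul_pow, mul_inv_cancel₀ ha, one_pow, one_mul, sub_smul,
      one_smul, ← add_sub_assoc, ← hzw]

theorem addHaar_quasiPolydisc_le [FiniteDimensional ℂ E] [MeasurableSpace E] [BorelSpace E]
    (μ : Measure E) [μ.IsAddHaarMeasure] {x : E} (hx : ‖x‖ = 1) {R : ℝ} (hR : 0 < R) :
    μ {z : E | ‖z‖ < 1 ∧ ‖1 - inner ℂ x z‖ < R} ≤
      ENNReal.ofReal (R ^ (Module.finrank ℂ E + 1)) * μ (ball 0 3) := by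
  have : FiniteDimensional ℝ E := FiniteDimensional.complexToReal E
  set L := (anisotropicDilation (Real.sqrt R) x).restrictScalars ℝ
  have hdet : LinearMap.det L = R ^ (Module.finrank ℂ E + 1) := by
    rw [LinearMap.det_restrictScalars, det_anisotropicDilation hx, Algebra.norm_complex_apply,
      map_pow, Complex.normSq_ofReal, Real.mul_self_sqrt hR.le]
  calc μ {z : E | ‖z‖ < 1 ∧ ‖1 - inner ℂ x z‖ < R}
      ≤ μ ((x + ·) '' (L '' ball 0 3)) := measure_mono (subset_image_anisotropicDilation hx hR)
    _ = ENNReal.ofReal (R ^ (Module.finrank ℂ E + 1)) * μ (ball 0 3) := by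
      rw [Set.image_add_left, measure_preimage_add, Measure.addHaar_image_linearMap, hdet,
        abs_of_pos (by positivity)]

end AnisotropicDilation

section Tanh

theorem tanh_mem_Ioo (s : ℝ) : Real.tanh s ∈ Set.Ioo (-1) 1 :=
  Real.tanh_bijOn.mapsTo (Set.mem_univ s)

theorem tanh_strictMono : StrictMono Real.tanh := fun s t hst =>
  (Real.artanh_lt_artanh_iff (tanh_mem_Ioo s) (tanh_mem_Ioo t)).1
    (by simpa only [Real.artanh_tanh] using hst)

theorem tanh_pos {s : ℝ} (hs : 0 < s) : 0 < Real.tanh s :=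
  Real.tanh_zero ▸ tanh_strictMono hs

theorem tanh_nonneg {s : ℝ} (hs : 0 ≤ s) : 0 ≤ Real.tanh s :=
  Real.tanh_zero ▸ tanh_strictMono.monotone hs

theorem one_sub_tanh (s : ℝ) :
    1 - Real.tanh s = 2 * Real.exp (-2 * s) / (1 + Real.exp (-2 * s)) := by
  have h : Real.exp (-2 * s) = Real.exp (-s) / Real.exp s := by
    rw [← Real.exp_sub]; ring_nf
  rw [Real.tanh_eq, h]
  field_simp
  ring

theorem exp_le_one_sub_tanh {s : ℝ} (hs : 0 ≤ s) : Real.exp (-2 * s) ≤ 1 - Real.tanh s := by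
  have hle : Real.exp (-2 * s) ≤ 1 := Real.exp_le_one_iff.2 (by linarith)
  have hpos := Real.exp_pos (-2 * s)
  rw [one_sub_tanh, le_div_iff₀ (by positivity)]
  nlinarith

theorem one_sub_tanh_le (s : ℝ) : 1 - Real.tanh s ≤ 2 * Real.exp (-2 * s) := by
  have hpos := Real.exp_pos (-2 * s)
  rw [one_sub_tanh]
  exact div_le_self (by positivity) (by linarith)

theorem exp_neg_two_mul_pow (θ₀ : ℝ) (k : ℕ) :
    Real.exp (-2 * θ₀) ^ k = Real.exp (-2 * (k * θ₀)) := by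
  rw [← Real.exp_nat_mul]; ring_nf

end Tanh

section Ball

variable {n : ℕ}

theorem mem_unitBall_iff {z : Cn n} : z ∈ unitBall n ↔ ‖z‖ < 1 :=
  mem_ball_zero_iff

theorem mem_unitSphere_iff {z : Cn n} : z ∈ unitSphere n ↔ ‖z‖ = 1 :=
  mem_sphere_zero_iff_norm

theorem unitSphere_nonempty (hn : 1 ≤ n) : (unitSphere n).Nonempty :=
  ⟨EuclideanSpace.single ⟨0, hn⟩ 1, by simp [mem_unitSphere_iff]⟩

theorem inv_norm_smul_mem_unitSphere {z : Cn n} (hz : z ≠ 0) : ‖z‖⁻¹ • z ∈ unitSphere n := by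
  simp [mem_unitSphere_iff, norm_smul, hz]

theorem bergmanDistZero_eq_artanh {z : Cn n} (hz : z ∈ unitBall n) :
    bergmanDistZero z = Real.artanh ‖z‖ := by
  rw [bergmanDistZero, Real.artanh_eq_half_log
    ⟨by linarith [norm_nonneg z], (mem_unitBall_iff.1 hz).le⟩]

theorem le_bergmanDistZero_iff {z : Cn n} (hz : z ∈ unitBall n) (s : ℝ) :
    s ≤ bergmanDistZero z ↔ Real.tanh s ≤ ‖z‖ := by
  rw [bergmanDistZero_eq_artanh hz, ← Real.artanh_le_artanh_iff (tanh_mem_Ioo s)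
    ⟨by linarith [norm_nonneg z], mem_unitBall_iff.1 hz⟩, Real.artanh_tanh]

theorem norm_radialProj {s : ℝ} (hs : 0 ≤ s) {z : Cn n} (hz : z ≠ 0) :
    ‖radialProj s z‖ = Real.tanh s := by
  rw [radialProj, norm_smul, norm_div, norm_norm, div_mul_cancel₀ _ (norm_ne_zero_iff.2 hz),
    Real.norm_of_nonneg (tanh_nonneg hs)]

theorem norm_one_sub_sub_one_sub_mul_le {p : ℂ} (hp : ‖p‖ ≤ 1) {t : ℝ} (ht : t ≤ 1) :
    ‖(1 - p) - (1 - t * p)‖ ≤ 1 - t := by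
  have h : (1 - p) - (1 - t * p) = ((t - 1 : ℝ) : ℂ) * p := by push_cast; ring
  rw [h, norm_mul, Complex.norm_real, Real.norm_of_nonpos (by linarith), neg_sub]
  exact mul_le_of_le_one_right (by linarith) hp

theorem norm_inner_le_one {ζ ω : Cn n} (hζ : ζ ∈ unitSphere n) (hω : ω ∈ unitSphere n) :
    ‖inner ℂ ζ ω‖ ≤ 1 := by
  simpa only [mem_unitSphere_iff.1 hζ, mem_unitSphere_iff.1 hω, mul_one]
    using norm_inner_le_norm (𝕜 := ℂ) ζ ω

theorem one_sub_norm_mul_norm_le (z w : Cn n) : 1 - ‖w‖ * ‖z‖ ≤ ‖1 - inner ℂ w z‖ := by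
  have h := norm_sub_norm_le (1 : ℂ) (inner ℂ w z)
  rw [norm_one] at h
  linarith [norm_inner_le_norm (𝕜 := ℂ) w z]

end Ball

section Cone

variable {n : ℕ}

/-- The cone over a set `Q` of unit vectors. It contains its vertex, even if `Q` is empty. -/
def cone (Q : Set (Cn n)) : Set (Cn n) := {z | z = 0 ∨ ‖z‖⁻¹ • z ∈ Q}

theorem mem_cone_iff {Q : Set (Cn n)} {z : Cn n} (hz : z ≠ 0) : z ∈ cone Q ↔ ‖z‖⁻¹ • z ∈ Q :=
  or_iff_right hz

theorem cone_mono {Q R : Set (Cn n)} (hQR : Q ⊆ R) : cone Q ⊆ cone R :=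
  fun _ hz => hz.imp_right fun h => hQR h

theorem cone_unitSphere : cone (unitSphere n) = Set.univ :=
  Set.eq_univ_of_forall fun z => (eq_or_ne z 0).imp_right inv_norm_smul_mem_unitSphere

theorem smul_mem_cone_iff {Q : Set (Cn n)} {t : ℝ} (ht : 0 < t) {z : Cn n} :
    t • z ∈ cone Q ↔ z ∈ cone Q := by
  simp only [cone, Set.mem_ofPred_eq, smul_eq_zero, ht.ne', false_or, norm_smul, smul_smul,
    Real.norm_of_nonneg ht.le, mul_inv]
  rw [mul_assoc, mul_comm, mul_assoc, mul_inv_cancel₀ ht.ne', mul_one]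

theorem measurableSet_cone {Q : Set (Cn n)} (hQ : MeasurableSet Q) : MeasurableSet (cone Q) :=
  (measurableSet_singleton 0).union
    ((by fun_prop : Measurable fun z : Cn n => ‖z‖⁻¹ • z) hQ)

theorem radialProj_mem_cone_iff {Q : Set (Cn n)} {s : ℝ} (hs : 0 < s) {z : Cn n} (hz : z ≠ 0) :
    radialProj s z ∈ cone Q ↔ z ∈ cone Q :=
  smul_mem_cone_iff (div_pos (tanh_pos hs) (norm_pos_iff.2 hz))

theorem radialProj_mem_image_iff {Q : Set (Cn n)} (hQ : Q ⊆ unitSphere n) {s : ℝ} (hs : 0 < s)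
    {z : Cn n} (hz : z ≠ 0) : radialProj s z ∈ radialProj s '' Q ↔ z ∈ cone Q := by
  have hproj : radialProj s z = Real.tanh s • (‖z‖⁻¹ • z) := by
    rw [radialProj, smul_smul, div_eq_mul_inv]
  have hproj_of_mem : ∀ q ∈ Q, radialProj s q = Real.tanh s • q := fun q hq => by
    rw [radialProj, mem_unitSphere_iff.1 (hQ hq), div_one]
  rw [mem_cone_iff hz, hproj]
  constructor
  · rintro ⟨q, hq, hqz⟩
    rw [hproj_of_mem q hq] at hqz
    exact smul_right_injective (Cn n) (tanh_pos hs).ne' hqz ▸ hq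
  · exact fun hz' => ⟨_, hz', hproj_of_mem _ hz'⟩

open Pointwise in
theorem volume_cone_inter_ball (Q : Set (Cn n)) {r : ℝ} (hr : 0 < r) :
    volume (cone Q ∩ ball 0 r) = ENNReal.ofReal (r ^ (2 * n)) * volume (cone Q ∩ ball 0 1) := by
  have hsmul : cone Q ∩ ball 0 r = r • (cone Q ∩ ball 0 1) := by
    ext z
    rw [Set.mem_smul_set_iff_inv_smul_mem₀ hr.ne']
    simp only [Set.mem_inter_iff, smul_mem_cone_iff (inv_pos.2 hr), mem_ball_zero_iff, norm_smul,
      norm_inv, Real.norm_of_nonneg hr.le, inv_mul_lt_iff₀ hr, mul_one]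
  rw [hsmul, Measure.addHaar_smul, abs_of_pos (by positivity)]
  simp [finrank_real_of_complex]

theorem volume_cone_inter_shell (hn : 1 ≤ n) {Q : Set (Cn n)} (hQ : MeasurableSet Q) {r : ℝ}
    (hr : 0 ≤ r) (hr1 : r ≤ 1) :
    volume {z | z ∈ unitBall n ∧ r ≤ ‖z‖ ∧ z ∈ cone Q} =
      ENNReal.ofReal (1 - r ^ (2 * n)) * volume (cone Q ∩ ball 0 1) := by
  have hdiff : {z | z ∈ unitBall n ∧ r ≤ ‖z‖ ∧ z ∈ cone Q} =
      (cone Q ∩ ball 0 1) \ (cone Q ∩ ball 0 r) := by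
    ext z
    simp only [unitBall, Set.mem_ofPred_eq, Set.mem_sdiff, Set.mem_inter_iff, mem_ball_zero_iff,
      not_and, not_lt]
    tauto
  have hfin : ∀ s : ℝ, volume (cone Q ∩ ball 0 s) ≠ ⊤ := fun s =>
    measure_ne_top_of_subset Set.inter_subset_right measure_ball_lt_top.ne
  rcases hr.eq_or_lt with rfl | hr
  · rw [hdiff]; simp [zero_pow (show 2 * n ≠ 0 by omega)]
  · rw [hdiff, measure_sdiff (Set.inter_subset_inter_right _ (ball_subset_ball hr1))
      ((measurableSet_cone hQ).inter measurableSet_ball).nullMeasurableSet (hfin r),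
      volume_cone_inter_ball Q hr, ENNReal.ofReal_sub _ (by positivity),
      ENNReal.sub_mul fun _ _ => hfin 1, ENNReal.ofReal_one, one_mul]

end Cone

namespace SphereDyadicSystem

variable {n : ℕ} {δ : ℝ} (Q : SphereDyadicSystem n δ)

theorem cube_subset (k : ℕ) (j : Fin (Q.card k)) : Q.cube k j ⊆ unitSphere n :=
  Q.iUnion_cube k ▸ Set.subset_iUnion _ j

theorem cone_cube_zero (j : Fin (Q.card 0)) : cone (Q.cube 0 j) = Set.univ := by
  rw [Q.cube_zero, cone_unitSphere]

theorem center_ne_zero (k : ℕ) (j : Fin (Q.card k)) : Q.center k j ≠ 0 :=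
  ne_zero_of_mem_unit_sphere (⟨_, Q.center_mem k j⟩ : sphere (0 : Cn n) 1)

theorem center_mem_cube (hδ : 0 < δ) (k : ℕ) (j : Fin (Q.card k)) :
    Q.center k j ∈ Q.cube k j := by
  obtain ⟨a, A, ha, -, h⟩ := Q.comparable
  refine (h k j).1 ⟨Q.center_mem k j, ?_⟩
  rw [inner_self_eq_norm_sq_to_K, mem_unitSphere_iff.1 (Q.center_mem k j)]
  simpa using by positivity

theorem subset_of_mem {k l : ℕ} (hkl : k ≤ l) {i : Fin (Q.card k)} {j : Fin (Q.card l)}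
    {z : Cn n} (hi : z ∈ Q.cube k i) (hj : z ∈ Q.cube l j) : Q.cube l j ⊆ Q.cube k i :=
  (Q.nested k l hkl i j).resolve_right (Set.not_disjoint_iff.2 ⟨z, hj, hi⟩)

theorem exists_mem_cube (k : ℕ) {z : Cn n} (hz : z ∈ unitSphere n) : ∃ j, z ∈ Q.cube k j :=
  Set.mem_iUnion.1 (Q.iUnion_cube k ▸ hz)

theorem eq_of_mem {k : ℕ} {i j : Fin (Q.card k)} {z : Cn n} (hi : z ∈ Q.cube k i)
    (hj : z ∈ Q.cube k j) : i = j :=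
  by_contra fun h => Set.disjoint_left.1 (Q.disjoint_cube k i j h) hi hj

variable {θ₀ : ℝ}

theorem mem_kubeSet_iff (hn : 1 ≤ n) (hθ : 0 < θ₀) (K : Q.Kube) (z : Cn n) :
    z ∈ Q.kubeSet θ₀ K ↔ z ∈ unitBall n ∧ K.1 * θ₀ ≤ bergmanDistZero z ∧
      bergmanDistZero z < (K.1 + 1) * θ₀ ∧ z ∈ cone (Q.cube K.1 K.2) := by
  refine and_congr_right fun hz => and_congr_right fun hKz => and_congr_right fun _ => ?_
  obtain ⟨k, j⟩ := K
  rcases k.eq_zero_or_pos with rfl | hk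
  · refine iff_of_true ?_ (Q.cone_cube_zero j ▸ Set.mem_univ z)
    obtain ⟨ζ, hζ⟩ := unitSphere_nonempty hn
    exact ⟨ζ, Q.cube_zero j ▸ hζ, by simp [radialProj]⟩
  · have hs : 0 < (k : ℝ) * θ₀ := by positivity
    exact radialProj_mem_image_iff (Q.cube_subset k j) hs
      (norm_pos_iff.1 ((tanh_pos hs).trans_le ((le_bergmanDistZero_iff hz _).1 hKz)))

theorem isChild_iff (hn : 1 ≤ n) (hθ : 0 < θ₀) (J K : Q.Kube) :
    Q.IsChild θ₀ J K ↔ J.1 = K.1 + 1 ∧ Q.center J.1 J.2 ∈ Q.cube K.1 K.2 := by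
  refine and_congr_right fun _ => ?_
  rw [Q.mem_kubeSet_iff hn hθ]
  obtain ⟨k, i⟩ := K
  set x := Q.center J.1 J.2
  have hx : x ∈ unitSphere n := Q.center_mem _ _
  have hx0 : x ≠ 0 := Q.center_ne_zero _ _
  have hs : 0 ≤ (k : ℝ) * θ₀ := by positivity
  have hball : radialProj (k * θ₀) x ∈ unitBall n := by
    rw [mem_unitBall_iff, norm_radialProj hs hx0]
    exact (tanh_mem_Ioo _).2
  have hdist : bergmanDistZero (radialProj (k * θ₀) x) = k * θ₀ := by
    rw [bergmanDistZero_eq_artanh hball, norm_radialProj hs hx0, Real.artanh_tanh]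
  have hcone : radialProj (k * θ₀) x ∈ cone (Q.cube k i) ↔ x ∈ Q.cube k i := by
    rcases k.eq_zero_or_pos with rfl | hk
    · exact iff_of_true (Q.cone_cube_zero i ▸ Set.mem_univ _) (Q.cube_zero i ▸ hx)
    · rw [radialProj_mem_cone_iff (by positivity) hx0, mem_cone_iff hx0,
        mem_unitSphere_iff.1 hx, inv_one, one_smul]
  simp only [hball, hdist, hcone, le_refl, add_mul, one_mul, lt_add_iff_pos_right, hθ, true_and]

theorem cube_subset_of_reflTransGen_isChild (hn : 1 ≤ n) (hδ : 0 < δ) (hθ : 0 < θ₀)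
    {J K : Q.Kube} (h : Relation.ReflTransGen (Q.IsChild θ₀) J K) :
    K.1 ≤ J.1 ∧ Q.cube J.1 J.2 ⊆ Q.cube K.1 K.2 := by
  induction h with
  | refl => exact ⟨le_rfl, subset_rfl⟩
  | tail _ h ih =>
    rw [Q.isChild_iff hn hθ] at h
    exact ⟨by omega, ih.2.trans (Q.subset_of_mem (by omega) h.2 (Q.center_mem_cube hδ _ _))⟩

theorem reflTransGen_isChild_of_mem (hn : 1 ≤ n) (hδ : 0 < δ) (hθ : 0 < θ₀) {k : ℕ}
    (i : Fin (Q.card k)) (d : ℕ) (j : Fin (Q.card (k + d))) {ζ : Cn n} (hi : ζ ∈ Q.cube k i)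
    (hj : ζ ∈ Q.cube (k + d) j) :
    Relation.ReflTransGen (Q.IsChild θ₀) ⟨k + d, j⟩ ⟨k, i⟩ := by
  induction d with
  | zero => rw [Q.eq_of_mem hi hj]; rfl
  | succ d ih =>
    obtain ⟨l, hl⟩ := Q.exists_mem_cube (k + d) (Q.cube_subset _ _ hi)
    exact .head ((Q.isChild_iff hn hθ _ _).2
      ⟨rfl, Q.subset_of_mem (by omega) hl hj (Q.center_mem_cube hδ _ _)⟩) (ih l hl)

theorem mem_tent_of_mem_cone (hn : 1 ≤ n) (hδ : 0 < δ) (hθ : 0 < θ₀) (k : ℕ)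
    (i : Fin (Q.card k)) (d : ℕ) {z : Cn n} (hz : z ∈ unitBall n)
    (hle : (k + d : ℕ) * θ₀ ≤ bergmanDistZero z) (hlt : bergmanDistZero z < ((k + d : ℕ) + 1) * θ₀)
    (hcone : z ∈ cone (Q.cube k i)) : z ∈ Q.tent θ₀ ⟨k, i⟩ := by
  rcases eq_or_ne z 0 with rfl | hz0
  · have hd : d = 0 := by
      by_contra hne
      have hpos : 0 < ((k + d : ℕ) : ℝ) * θ₀ :=
        mul_pos (Nat.cast_pos.2 (by omega)) hθ
      rw [le_bergmanDistZero_iff hz, norm_zero] at hle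
      exact hle.not_gt (tanh_pos hpos)
    subst hd
    exact ⟨⟨k, i⟩, .refl, (Q.mem_kubeSet_iff hn hθ _ _).2 ⟨hz, hle, hlt, hcone⟩⟩
  · obtain ⟨j, hj⟩ := Q.exists_mem_cube (k + d) (inv_norm_smul_mem_unitSphere hz0)
    exact ⟨⟨k + d, j⟩,
      Q.reflTransGen_isChild_of_mem hn hδ hθ i d j ((mem_cone_iff hz0).1 hcone) hj,
      (Q.mem_kubeSet_iff hn hθ _ _).2 ⟨hz, hle, hlt, (mem_cone_iff hz0).2 hj⟩⟩

theorem mem_tent_iff (hn : 1 ≤ n) (hδ : 0 < δ) (hθ : 0 < θ₀) (K : Q.Kube) (z : Cn n) :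
    z ∈ Q.tent θ₀ K ↔
      z ∈ unitBall n ∧ Real.tanh (K.1 * θ₀) ≤ ‖z‖ ∧ z ∈ cone (Q.cube K.1 K.2) := by
  constructor
  · rintro ⟨J, hJ, hz⟩
    obtain ⟨hKJ, hsub⟩ := Q.cube_subset_of_reflTransGen_isChild hn hδ hθ hJ
    obtain ⟨hball, hle, -, hcone⟩ := (Q.mem_kubeSet_iff hn hθ J z).1 hz
    refine ⟨hball, (le_bergmanDistZero_iff hball _).1 (le_trans ?_ hle), cone_mono hsub hcone⟩
    gcongr
  · rintro ⟨hz, hK, hcone⟩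
    rw [← le_bergmanDistZero_iff hz, ← le_div_iff₀ hθ] at hK
    set m := ⌊bergmanDistZero z / θ₀⌋₊
    obtain ⟨d, hd⟩ := Nat.exists_eq_add_of_le (Nat.le_floor hK : K.1 ≤ m)
    refine Q.mem_tent_of_mem_cone hn hδ hθ K.1 K.2 d hz ?_ ?_ hcone <;> rw [← hd]
    · exact (le_div_iff₀ hθ).1 (Nat.floor_le ((Nat.cast_nonneg _).trans hK))
    · exact (div_lt_iff₀ hθ).1 (Nat.lt_floor_add_one _)

theorem tent_subset_unitBall (K : Q.Kube) : Q.tent θ₀ K ⊆ unitBall n :=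
  fun _ ⟨_, _, hz⟩ => hz.1

theorem tent_zero (hn : 1 ≤ n) (hδ : 0 < δ) (hθ : 0 < θ₀) (j : Fin (Q.card 0)) :
    Q.tent θ₀ ⟨0, j⟩ = unitBall n := by
  ext z
  simp [Q.mem_tent_iff hn hδ hθ, Q.cone_cube_zero]

theorem ne_zero_of_mem_tent (hn : 1 ≤ n) (hδ : 0 < δ) (hθ : 0 < θ₀) {K : Q.Kube} (hK : 0 < K.1)
    {z : Cn n} (hz : z ∈ Q.tent θ₀ K) : z ≠ 0 :=
  norm_pos_iff.1 ((tanh_pos (mul_pos (Nat.cast_pos.2 hK) hθ)).trans_le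
    ((Q.mem_tent_iff hn hδ hθ K z).1 hz).2.1)

theorem measurableSet_tent (hn : 1 ≤ n) (hδ : 0 < δ) (hθ : 0 < θ₀) (K : Q.Kube) :
    MeasurableSet (Q.tent θ₀ K) := by
  rw [Set.ext (Q.mem_tent_iff hn hδ hθ K)]
  exact measurableSet_ball.inter ((measurableSet_le measurable_const measurable_norm).inter
    (measurableSet_cone (Q.measurableSet_cube _ _)))

theorem tent_subset_tent (hn : 1 ≤ n) (hδ : 0 < δ) (hθ : 0 < θ₀) {J K : Q.Kube}
    (hKJ : K.1 ≤ J.1) {z : Cn n} (hzJ : z ∈ Q.tent θ₀ J) (hzK : z ∈ Q.tent θ₀ K) :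
    Q.tent θ₀ J ⊆ Q.tent θ₀ K := by
  obtain ⟨k, i⟩ := K
  rcases k.eq_zero_or_pos with rfl | hk
  · exact Q.tent_zero hn hδ hθ i ▸ Q.tent_subset_unitBall J
  · have hz0 := Q.ne_zero_of_mem_tent hn hδ hθ hk hzK
    intro w hw
    simp only [Q.mem_tent_iff hn hδ hθ, mem_cone_iff hz0] at hzJ hzK hw ⊢
    refine ⟨hw.1, le_trans (tanh_strictMono.monotone ?_) hw.2.1,
      cone_mono (Q.subset_of_mem hKJ hzK.2.2 hzJ.2.2) hw.2.2⟩
    gcongr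

theorem eq_of_mem_tent (hn : 1 ≤ n) (hδ : 0 < δ) (hθ : 0 < θ₀) {k : ℕ} {i j : Fin (Q.card k)}
    {z : Cn n} (hi : z ∈ Q.tent θ₀ ⟨k, i⟩) (hj : z ∈ Q.tent θ₀ ⟨k, j⟩) : i = j := by
  rcases k.eq_zero_or_pos with rfl | hk
  · obtain ⟨ζ, hζ⟩ := unitSphere_nonempty hn
    exact Q.eq_of_mem (Q.cube_zero i ▸ hζ) (Q.cube_zero j ▸ hζ)
  · have hz0 := Q.ne_zero_of_mem_tent hn hδ hθ hk hi
    rw [Q.mem_tent_iff hn hδ hθ, mem_cone_iff hz0] at hi hj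
    exact Q.eq_of_mem hi.2.2 hj.2.2

end SphereDyadicSystem

section Size

variable {n : ℕ} {θ₀ : ℝ}

theorem one_sub_tanh_pow_le (hn : 1 ≤ n) (hθ : 0 < θ₀) (k d : ℕ) :
    1 - Real.tanh ((k + d : ℕ) * θ₀) ^ (2 * n) ≤
      4 * n * Real.exp (-2 * θ₀) ^ d * (1 - Real.tanh (k * θ₀) ^ (2 * n)) := by
  set r := Real.tanh ((k + d : ℕ) * θ₀)
  set s := Real.tanh (k * θ₀)
  have hr : 0 ≤ r := tanh_nonneg (by positivity)
  have hs : 0 ≤ s := tanh_nonneg (by positivity)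
  have hbernoulli : 1 - r ^ (2 * n) ≤ 2 * n * (1 - r) := by
    have h := one_add_mul_le_pow (show -2 ≤ r - 1 by linarith) (2 * n)
    rw [add_sub_cancel] at h
    push_cast at h
    linarith
  have hr' : 1 - r ≤ 2 * (Real.exp (-2 * θ₀) ^ d * Real.exp (-2 * θ₀) ^ k) := by
    rw [← pow_add, add_comm, exp_neg_two_mul_pow]
    exact one_sub_tanh_le _
  have hs' : Real.exp (-2 * θ₀) ^ k ≤ 1 - s ^ (2 * n) := by
    rw [exp_neg_two_mul_pow]
    linarith [exp_le_one_sub_tanh (show 0 ≤ k * θ₀ by positivity),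
      pow_le_of_le_one hs (tanh_mem_Ioo _).2.le (show 2 * n ≠ 0 by omega)]
  calc 1 - r ^ (2 * n)
      ≤ 2 * n * (2 * (Real.exp (-2 * θ₀) ^ d * Real.exp (-2 * θ₀) ^ k)) :=
        hbernoulli.trans (by gcongr)
    _ = 4 * n * Real.exp (-2 * θ₀) ^ d * Real.exp (-2 * θ₀) ^ k := by ring
    _ ≤ 4 * n * Real.exp (-2 * θ₀) ^ d * (1 - s ^ (2 * n)) := by gcongr

namespace SphereDyadicSystem

variable (Q : SphereDyadicSystem n (Real.exp (-2 * θ₀)))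

theorem volume_tent_inter_le (hn : 1 ≤ n) (hθ : 0 < θ₀) (K : Q.Kube) (d : ℕ) :
    volume (Q.tent θ₀ K ∩ {z | Real.tanh ((K.1 + d : ℕ) * θ₀) ≤ ‖z‖}) ≤
      ENNReal.ofReal (4 * n * Real.exp (-2 * θ₀) ^ d) * volume (Q.tent θ₀ K) := by
  have hmem := Q.mem_tent_iff hn (Real.exp_pos _) hθ K
  have hsub : Q.tent θ₀ K ∩ {z | Real.tanh ((K.1 + d : ℕ) * θ₀) ≤ ‖z‖} ⊆
      {z | z ∈ unitBall n ∧ Real.tanh ((K.1 + d : ℕ) * θ₀) ≤ ‖z‖ ∧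
        z ∈ cone (Q.cube K.1 K.2)} :=
    fun z ⟨hz, hz'⟩ => ⟨((hmem z).1 hz).1, hz', ((hmem z).1 hz).2.2⟩
  refine (measure_mono hsub).trans ?_
  rw [Set.ext hmem]
  change _ ≤ _ * volume {z | z ∈ unitBall n ∧ _}
  rw [volume_cone_inter_shell hn (Q.measurableSet_cube _ _) (tanh_nonneg (by positivity))
      (tanh_mem_Ioo _).2.le,
    volume_cone_inter_shell hn (Q.measurableSet_cube _ _) (tanh_nonneg (by positivity))
      (tanh_mem_Ioo _).2.le, ← mul_assoc, ← ENNReal.ofReal_mul (by positivity)]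
  gcongr
  exact one_sub_tanh_pow_le hn hθ K.1 d

theorem tent_subset_quasiPolydisc (hn : 1 ≤ n) (hθ : 0 < θ₀) {A : ℝ} (hA : 0 < A) (K : Q.Kube)
    (hK : Q.cube K.1 K.2 ⊆ quasiBall (Q.center K.1 K.2) (A * Real.exp (-2 * θ₀) ^ K.1)) :
    Q.tent θ₀ K ⊆ {z | ‖z‖ < 1 ∧
      ‖1 - inner ℂ (Q.center K.1 K.2) z‖ < (A + 2) * Real.exp (-2 * θ₀) ^ K.1} := by
  intro z hz
  obtain ⟨hz1, hKz, hcone⟩ := (Q.mem_tent_iff hn (Real.exp_pos _) hθ K z).1 hz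
  rw [mem_unitBall_iff] at hz1
  refine ⟨hz1, ?_⟩
  set x := Q.center K.1 K.2
  have hnear : 1 - ‖z‖ ≤ 2 * Real.exp (-2 * θ₀) ^ K.1 := by
    rw [exp_neg_two_mul_pow]
    linarith [one_sub_tanh_le (K.1 * θ₀)]
  rcases eq_or_ne z 0 with rfl | hz0
  · have : 0 < A * Real.exp (-2 * θ₀) ^ K.1 := by positivity
    simp only [norm_zero, sub_zero, inner_zero_right, norm_one] at hnear ⊢
    linarith
  · set ζ := ‖z‖⁻¹ • z
    have hζ : ‖inner ℂ x ζ‖ ≤ 1 :=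
      norm_inner_le_one (Q.center_mem _ _) (inv_norm_smul_mem_unitSphere hz0)
    have hzζ : inner ℂ x z = (‖z‖ : ℂ) * inner ℂ x ζ := by
      rw [← inner_smul_right, Complex.coe_smul, smul_inv_smul₀ (norm_ne_zero_iff.2 hz0)]
    have hcube : ‖1 - inner ℂ x ζ‖ < A * Real.exp (-2 * θ₀) ^ K.1 := by
      rw [← inner_conj_symm, ← map_one (starRingEnd ℂ), ← map_sub, RCLike.norm_conj]
      exact (hK ((mem_cone_iff hz0).1 hcone)).2
    rw [hzζ]
    linarith [norm_le_norm_add_norm_sub' (1 - (‖z‖ : ℂ) * inner ℂ x ζ) (1 - inner ℂ x ζ),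
      norm_sub_rev (1 - inner ℂ x ζ) (1 - (‖z‖ : ℂ) * inner ℂ x ζ),
      norm_one_sub_sub_one_sub_mul_le hζ hz1.le]

theorem exists_volume_tent_le (hn : 1 ≤ n) (hθ : 0 < θ₀) : ∃ C : ENNReal, C ≠ ⊤ ∧
    ∀ K : Q.Kube, volume (Q.tent θ₀ K) ≤
      C * ENNReal.ofReal (Real.exp (-2 * θ₀) ^ (K.1 * (n + 1))) := by
  obtain ⟨a, A, -, hA, hQ⟩ := Q.comparable
  refine ⟨ENNReal.ofReal ((A + 2) ^ (n + 1)) * volume (ball (0 : Cn n) 3),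
    ENNReal.mul_ne_top ENNReal.ofReal_ne_top measure_ball_lt_top.ne, fun K => ?_⟩
  refine (measure_mono (Q.tent_subset_quasiPolydisc hn hθ hA K (hQ K.1 K.2).2)).trans
    ((addHaar_quasiPolydisc_le volume (mem_unitSphere_iff.1 (Q.center_mem _ _))
      (by positivity)).trans_eq ?_)
  rw [finrank_euclideanSpace_fin, mul_pow, ← pow_mul, ENNReal.ofReal_mul (by positivity)]
  ring

end SphereDyadicSystem

end Size

/-! ### Common tents of two points -/

section CommonTent

variable {n : ℕ} {θ₀ : ℝ}

theorem exists_unitSphere_smul_eq (hn : 1 ≤ n) (z : Cn n) : ∃ ζ ∈ unitSphere n, ‖z‖ • ζ = z := by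
  rcases eq_or_ne z 0 with rfl | hz
  · obtain ⟨ζ, hζ⟩ := unitSphere_nonempty hn
    exact ⟨ζ, hζ, by simp⟩
  · exact ⟨_, inv_norm_smul_mem_unitSphere hz, smul_inv_smul₀ (norm_ne_zero_iff.2 hz) z⟩

theorem smul_mem_cone {Q : Set (Cn n)} {ζ : Cn n} (hζ : ζ ∈ unitSphere n) (hζQ : ζ ∈ Q) {t : ℝ}
    (ht : 0 ≤ t) : t • ζ ∈ cone Q := by
  rcases ht.eq_or_lt with rfl | ht
  · exact Or.inl (zero_smul ℝ ζ)
  · exact (smul_mem_cone_iff ht).2 (Or.inr (by simpa [mem_unitSphere_iff.1 hζ] using hζQ))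

theorem norm_one_sub_inner_le_two_mul {ζ ω : Cn n} (hζ : ζ ∈ unitSphere n) (hω : ω ∈ unitSphere n)
    {s t : ℝ} (hs : 0 ≤ s) (hs1 : s ≤ 1) (ht : 0 ≤ t) (ht1 : t ≤ 1) :
    ‖1 - inner ℂ ω ζ‖ ≤ 2 * ‖1 - inner ℂ (s • ω) (t • ζ)‖ := by
  have hbound := one_sub_norm_mul_norm_le (t • ζ) (s • ω)
  have hp := norm_inner_le_one hω hζ
  rw [mem_unitSphere_iff] at hζ hω
  have hinner : inner ℂ (s • ω) (t • ζ) = ((s * t : ℝ) : ℂ) * inner ℂ ω ζ := by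
    rw [← Complex.coe_smul, ← Complex.coe_smul, inner_smul_left, inner_smul_right,
      Complex.conj_ofReal]
    push_cast
    ring
  rw [norm_smul, norm_smul, hζ, hω, mul_one, mul_one, Real.norm_of_nonneg hs,
    Real.norm_of_nonneg ht] at hbound
  rw [hinner] at hbound ⊢
  linarith [norm_le_norm_add_norm_sub' (1 - inner ℂ ω ζ) (1 - ((s * t : ℝ) : ℂ) * inner ℂ ω ζ),
    norm_one_sub_sub_one_sub_mul_le hp (mul_le_one₀ hs1 ht ht1)]

theorem DyadicFamily.exists_cube_mem_mem (D : DyadicFamily n θ₀) :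
    ∃ A : ℝ, 0 < A ∧ ∀ ζ ∈ unitSphere n, ∀ ω ∈ unitSphere n, ∀ d, ‖1 - inner ℂ ω ζ‖ < d →
      ∃ (ℓ : Fin D.N) (k : ℕ) (j : Fin ((D.system ℓ).card k)),
        ζ ∈ (D.system ℓ).cube k j ∧ ω ∈ (D.system ℓ).cube k j ∧
          Real.exp (-2 * θ₀) ^ k ≤ A * d := by
  obtain ⟨A, hA, happrox⟩ := D.approx
  refine ⟨A, hA, fun ζ hζ ω hω d hd => ?_⟩
  have hd0 : 0 < d := (norm_nonneg _).trans_lt hd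
  rcases le_or_gt (A * d) 1 with hAd | hAd
  · obtain ⟨ℓ, k, j, hball, hk⟩ := happrox ζ hζ d hd0 hAd
    refine ⟨ℓ, k, j, hball ⟨hζ, ?_⟩, hball ⟨hω, hd⟩, hk⟩
    simpa [inner_self_eq_norm_sq_to_K, mem_unitSphere_iff.1 hζ] using hd0
  · obtain ⟨ℓ, -⟩ := happrox ζ hζ (1 / A) (by positivity) (mul_one_div_cancel hA.ne').le
    obtain ⟨j, hj⟩ := (D.system ℓ).exists_mem_cube 0 hζ
    exact ⟨ℓ, 0, j, hj, (D.system ℓ).cube_zero j ▸ hω, by simpa using hAd.le⟩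

theorem exists_le_pow_of_pow_le {δ C d : ℝ} (hδ : 0 < δ) (hd : d ≤ δ * C) {k : ℕ}
    (hk : δ ^ k ≤ C) : ∃ m ≤ k, (m = 0 ∨ d ≤ δ ^ m) ∧ δ ^ m ≤ C := by
  induction k with
  | zero => exact ⟨0, le_rfl, Or.inl rfl, hk⟩
  | succ k ih =>
    rcases le_or_gt d (δ ^ (k + 1)) with hdk | hdk
    · exact ⟨k + 1, le_rfl, Or.inr hdk, hk⟩
    · rw [pow_succ'] at hdk
      obtain ⟨m, hm, hmd⟩ := ih (le_of_mul_le_mul_left (hdk.le.trans hd) hδ)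
      exact ⟨m, hm.trans k.le_succ, hmd⟩

theorem tanh_le_of_one_sub_le {m : ℕ} (hθ : 0 < θ₀) {t d : ℝ} (ht : 0 ≤ t) (htd : 1 - t ≤ d)
    (hm : m = 0 ∨ d ≤ Real.exp (-2 * θ₀) ^ m) : Real.tanh (m * θ₀) ≤ t := by
  rcases hm with rfl | hm
  · simpa using ht
  · rw [exp_neg_two_mul_pow] at hm
    linarith [exp_le_one_sub_tanh (s := m * θ₀) (by positivity)]

theorem DyadicFamily.exists_tent_mem_mem (hn : 1 ≤ n) (hθ : 0 < θ₀) (D : DyadicFamily n θ₀) :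
    ∃ C : ℝ, 0 < C ∧ ∀ z ∈ unitBall n, ∀ w ∈ unitBall n,
      ∃ (ℓ : Fin D.N) (K : (D.system ℓ).Kube), z ∈ (D.system ℓ).tent θ₀ K ∧
        w ∈ (D.system ℓ).tent θ₀ K ∧ Real.exp (-2 * θ₀) ^ K.1 ≤ C * ‖1 - inner ℂ w z‖ := by
  obtain ⟨A, hA, hcube⟩ := D.exists_cube_mem_mem
  set δ := Real.exp (-2 * θ₀)
  have hδ : 0 < δ := Real.exp_pos _
  refine ⟨3 * A + δ⁻¹, by positivity, fun z hz w hw => ?_⟩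
  have hz1 := mem_unitBall_iff.1 hz
  have hw1 := mem_unitBall_iff.1 hw
  have hdwz := one_sub_norm_mul_norm_le z w
  obtain ⟨ζ, hζ, hzζ⟩ := exists_unitSphere_smul_eq hn z
  obtain ⟨ω, hω, hwω⟩ := exists_unitSphere_smul_eq hn w
  have hdir := norm_one_sub_inner_le_two_mul hζ hω (norm_nonneg w) hw1.le (norm_nonneg z) hz1.le
  rw [hzζ, hwω] at hdir
  set d := ‖1 - inner ℂ w z‖
  have hdz : 1 - ‖z‖ ≤ d := by nlinarith [norm_nonneg z]
  have hdw : 1 - ‖w‖ ≤ d := by nlinarith [norm_nonneg w]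
  have hd : 0 < d := by linarith
  obtain ⟨ℓ, k, j, hζj, hωj, hk⟩ := hcube ζ hζ ω hω (3 * d) (by linarith)
  -- Climb from the cube containing both directions until the tent reaches down to `z` and `w`.
  obtain ⟨m, hmk, hm, hmd⟩ := exists_le_pow_of_pow_le (d := d) (C := (3 * A + δ⁻¹) * d) hδ
    (by rw [add_mul, mul_add, ← mul_assoc δ δ⁻¹, mul_inv_cancel₀ hδ.ne', one_mul]
        exact le_add_of_nonneg_left (by positivity))
    (hk.trans (by rw [add_mul]; linarith [mul_pos (inv_pos.2 hδ) hd]))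
  obtain ⟨i, hi⟩ := (D.system ℓ).exists_mem_cube m hζ
  have hωi := (D.system ℓ).subset_of_mem hmk hi hζj hωj
  refine ⟨ℓ, ⟨m, i⟩, ?_, ?_, hmd⟩ <;> rw [(D.system ℓ).mem_tent_iff hn hδ hθ]
  · exact ⟨hz, tanh_le_of_one_sub_le hθ (norm_nonneg z) hdz hm,
      hzζ ▸ smul_mem_cone hζ hi (norm_nonneg z)⟩
  · exact ⟨hw, tanh_le_of_one_sub_le hθ (norm_nonneg w) hdw hm,
      hwω ▸ smul_mem_cone hω hωi (norm_nonneg w)⟩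

end CommonTent

/-! ### Square functions on trees of tents -/

/-- A tree of tents of measure at most a multiple of their `size`, indexed by a generation and a
position in it. The tents have thin tops: those `d` generations below a tent `K` cover at most the
fraction `bound * ratio ^ d` of `K`. This is all that is used of dyadic Carleson tents. -/
structure TentTree {α : Type*} [MeasurableSpace α] (ι : ℕ → Type*) (μ : Measure α) where
  /-- the tents -/
  tent : ((k : ℕ) × ι k) → Set α
  /-- the normalization of averages over the tents -/
  size : ((k : ℕ) × ι k) → ℝ≥0∞
  /-- the rate at which the tops of tents decay -/
  ratio : ℝ≥0∞
  /-- the constant of the geometric estimates -/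
  bound : ℝ≥0∞
  size_ne_zero : ∀ K, size K ≠ 0
  size_ne_top : ∀ K, size K ≠ ⊤
  ratio_ne_zero : ratio ≠ 0
  ratio_lt_one : ratio < 1
  bound_ne_top : bound ≠ ⊤
  measurableSet_tent : ∀ K, MeasurableSet (tent K)
  nested : ∀ {J K z}, K.1 ≤ J.1 → z ∈ tent J → z ∈ tent K → tent J ⊆ tent K
  eq_of_mem : ∀ {k i j z}, z ∈ tent ⟨k, i⟩ → z ∈ tent ⟨k, j⟩ → i = j
  measure_inter_le : ∀ K d, μ (tent K ∩ ⋃ j, tent ⟨K.1 + d, j⟩) ≤ bound * ratio ^ d * μ (tent K)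
  measure_le : ∀ K, μ (tent K) ≤ bound * size K

namespace TentTree

variable {α : Type*} [MeasurableSpace α] {ι : ℕ → Type*} {μ : Measure α} (T : TentTree ι μ)

/-- The union of the tents of generation `m`. -/
def layer (m : ℕ) : Set α := ⋃ j, T.tent ⟨m, j⟩

/-- The average of `F` over the tent `K`, normalized by the size of `K`. -/
noncomputable def avg (F : α → ℝ≥0∞) (K : (k : ℕ) × ι k) : ℝ≥0∞ :=
  (T.size K)⁻¹ * ∫⁻ z in T.tent K, F z ∂μ

/-- The tents inside `K` of the generation of `K` or a later one. -/
def descendants (K : (k : ℕ) × ι k) : Set ((k : ℕ) × ι k) :=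
  {J | K.1 ≤ J.1 ∧ T.tent J ⊆ T.tent K}

/-- The tents of the family `H` that lie in no tent of `H` of an earlier generation. -/
def maximals (H : Set ((k : ℕ) × ι k)) : Set ((k : ℕ) × ι k) :=
  {K | K ∈ H ∧ ∀ J ∈ H, J.1 < K.1 → ¬ T.tent K ⊆ T.tent J}

/-- The constant of the Carleson packing condition relative to the sizes of the tents. -/
noncomputable def packingConst : ℝ≥0∞ := T.bound ^ 2 * (1 - T.ratio)⁻¹

theorem packingConst_ne_top : T.packingConst ≠ ⊤ :=
  ENNReal.mul_ne_top (ENNReal.pow_ne_top T.bound_ne_top)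
    (ENNReal.inv_ne_top.2 (tsub_pos_of_lt T.ratio_lt_one).ne')

theorem mul_size_le_lintegral {F : α → ℝ≥0∞} {a : ℝ≥0∞} {K : (k : ℕ) × ι k}
    (h : a ≤ T.avg F K) : a * T.size K ≤ ∫⁻ z in T.tent K, F z ∂μ := by
  calc a * T.size K ≤ T.avg F K * T.size K := by gcongr
    _ = ((T.size K)⁻¹ * T.size K) * ∫⁻ z in T.tent K, F z ∂μ := by rw [avg]; ring
    _ = ∫⁻ z in T.tent K, F z ∂μ := by
      rw [ENNReal.inv_mul_cancel (T.size_ne_zero K) (T.size_ne_top K), one_mul]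

theorem exists_mem_maximals {H : Set ((k : ℕ) × ι k)} {K : (k : ℕ) × ι k} (hK : K ∈ H) :
    ∃ J ∈ T.maximals H, K ∈ T.descendants J := by
  induction hk : K.1 using Nat.strong_induction_on generalizing K with
  | _ k ih =>
    by_cases h : K ∈ T.maximals H
    · exact ⟨K, h, le_rfl, subset_rfl⟩
    · simp only [maximals, Set.mem_ofPred_eq, hK, true_and, not_forall, not_not] at h
      obtain ⟨L, hL, hLK, hsub⟩ := h
      obtain ⟨J, hJ, hJL, hLJ⟩ := ih L.1 (hk ▸ hLK) hL rfl
      exact ⟨J, hJ, hJL.trans hLK.le, hsub.trans hLJ⟩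

theorem pairwise_disjoint_maximals (H : Set ((k : ℕ) × ι k)) :
    Pairwise (Function.onFun Disjoint fun K : T.maximals H => T.tent K) := by
  rintro ⟨⟨k, i⟩, hK⟩ ⟨⟨l, j⟩, hJ⟩ hne
  refine Set.disjoint_left.2 fun z hz hz' => hne ?_
  rcases lt_trichotomy k l with h | rfl | h
  · exact absurd (T.nested h.le hz' hz) (hJ.2 _ hK.1 h)
  · obtain rfl := T.eq_of_mem hz hz'
    rfl
  · exact absurd (T.nested h.le hz hz') (hK.2 _ hJ.1 h)

section Countable

variable [∀ k, Countable (ι k)]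

theorem measurableSet_layer (m : ℕ) : MeasurableSet (T.layer m) :=
  MeasurableSet.iUnion fun _ => T.measurableSet_tent _

theorem tsum_measure_generation_le (K : (k : ℕ) × ι k) (m : ℕ) :
    ∑' j, (T.descendants K).indicator (fun J => μ (T.tent J)) ⟨m, j⟩ ≤
      μ (T.tent K ∩ T.layer m) := by
  calc ∑' j, (T.descendants K).indicator (fun J => μ (T.tent J)) ⟨m, j⟩
      ≤ ∑' j, μ (T.tent K ∩ T.tent ⟨m, j⟩) := by
        refine ENNReal.tsum_le_tsum fun j => Set.indicator_apply_le' (fun h => ?_) fun _ => zero_le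
        rw [Set.inter_eq_self_of_subset_right h.2]
    _ = μ (T.tent K ∩ T.layer m) := by
        rw [layer, Set.inter_iUnion, measure_iUnion]
        · exact fun i j hij => Set.disjoint_left.2 fun z hi hj => hij (T.eq_of_mem hi.2 hj.2)
        · exact fun j => (T.measurableSet_tent K).inter (T.measurableSet_tent _)

theorem tsum_measure_descendants_le (K : (k : ℕ) × ι k) :
    ∑' J : T.descendants K, μ (T.tent J) ≤ T.bound * (1 - T.ratio)⁻¹ * μ (T.tent K) := by
  have hlow : ∑ m ∈ Finset.range K.1,
      ∑' j, (T.descendants K).indicator (fun J => μ (T.tent J)) ⟨m, j⟩ = 0 := by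
    refine Finset.sum_eq_zero fun m hm => ENNReal.tsum_eq_zero.2 fun j => ?_
    exact Set.indicator_of_notMem (fun h => (Finset.mem_range.1 hm).not_ge h.1) _
  rw [tsum_subtype (T.descendants K) fun J => μ (T.tent J), ENNReal.tsum_sigma',
    ← ENNReal.summable.sum_add_tsum_nat_add' (k := K.1), hlow, zero_add]
  calc ∑' d, ∑' j, (T.descendants K).indicator (fun J => μ (T.tent J)) ⟨d + K.1, j⟩
      ≤ ∑' d, T.bound * T.ratio ^ d * μ (T.tent K) := by
        refine ENNReal.tsum_le_tsum fun d => (T.tsum_measure_generation_le K _).trans ?_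
        rw [add_comm]
        exact T.measure_inter_le K d
    _ = T.bound * (1 - T.ratio)⁻¹ * μ (T.tent K) := by
        rw [ENNReal.tsum_mul_right, ENNReal.tsum_mul_left, ENNReal.tsum_geometric]

theorem tsum_measure_le_tsum_maximals (H : Set ((k : ℕ) × ι k)) :
    ∑' K : H, μ (T.tent K) ≤
      T.bound * (1 - T.ratio)⁻¹ * ∑' J : T.maximals H, μ (T.tent J) := by
  have hcover : H ⊆ ⋃ J : T.maximals H, T.descendants J := fun K hK => by
    obtain ⟨J, hJ, hKJ⟩ := T.exists_mem_maximals hK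
    exact Set.mem_iUnion.2 ⟨⟨J, hJ⟩, hKJ⟩
  calc ∑' K : H, μ (T.tent K)
      ≤ ∑' K : ⋃ J : T.maximals H, T.descendants J, μ (T.tent K) :=
        ENNReal.tsum_mono_subtype (fun K => μ (T.tent K)) hcover
    _ ≤ ∑' J : T.maximals H, ∑' K : T.descendants J, μ (T.tent K) :=
        ENNReal.tsum_iUnion_le_tsum (fun K => μ (T.tent K)) _
    _ ≤ ∑' J : T.maximals H, T.bound * (1 - T.ratio)⁻¹ * μ (T.tent J) :=
        ENNReal.tsum_le_tsum fun J => T.tsum_measure_descendants_le J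
    _ = T.bound * (1 - T.ratio)⁻¹ * ∑' J : T.maximals H, μ (T.tent J) := ENNReal.tsum_mul_left

theorem mul_tsum_measure_le (F : α → ℝ≥0∞) (a : ℝ≥0∞) :
    a * ∑' K : {K | a ≤ T.avg F K}, μ (T.tent K) ≤
      T.packingConst * ∫⁻ z in ⋃ K, T.tent K, F z ∂μ := by
  set H := {K | a ≤ T.avg F K}
  calc a * ∑' K : H, μ (T.tent K)
      ≤ a * (T.bound * (1 - T.ratio)⁻¹ * ∑' J : T.maximals H, T.bound * T.size J) := by
        gcongr
        refine (T.tsum_measure_le_tsum_maximals H).trans ?_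
        gcongr
        exact T.measure_le _
    _ = T.packingConst * ∑' J : T.maximals H, a * T.size J := by
        simp_rw [ENNReal.tsum_mul_left, packingConst]
        ring
    _ ≤ T.packingConst * ∑' J : T.maximals H, ∫⁻ z in T.tent J, F z ∂μ := by
        gcongr with J
        exact T.mul_size_le_lintegral J.2.1
    _ = T.packingConst * ∫⁻ z in ⋃ J : T.maximals H, T.tent J, F z ∂μ := by
        rw [lintegral_iUnion (fun J => T.measurableSet_tent _) (T.pairwise_disjoint_maximals H)]
    _ ≤ T.packingConst * ∫⁻ z in ⋃ K, T.tent K, F z ∂μ := by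
        gcongr
        exact Set.iUnion_subset fun J => Set.subset_iUnion T.tent J

end Countable

end TentTree

theorem exists_two_inv_pow_le {x : ℝ≥0∞} (hx0 : x ≠ 0) (hx1 : x ≤ 1) :
    ∃ m : ℕ, 2⁻¹ ^ (m + 1) ≤ x ∧ x ≤ 2⁻¹ ^ m := by
  lift x to NNReal using (hx1.trans_lt ENNReal.one_lt_top).ne
  obtain ⟨m, hlt, hle⟩ := exists_nat_pow_near_of_lt_one (y := (2⁻¹ : NNReal))
    (pos_iff_ne_zero.2 (ENNReal.coe_ne_zero.1 hx0)) (ENNReal.coe_le_one_iff.1 hx1)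
    (by norm_num) (by norm_num)
  refine ⟨m, ?_⟩
  rw [← ENNReal.coe_ofNat, ← ENNReal.coe_inv two_ne_zero]
  exact_mod_cast And.intro hlt.le hle

namespace TentTree

variable {α : Type*} [MeasurableSpace α] {ι : ℕ → Type*} {μ : Measure α} (T : TentTree ι μ)
  [∀ k, Countable (ι k)]

theorem tsum_measure_mul_avg_rpow_level_le {s : ℝ} (hs : 0 ≤ s) (F : α → ℝ≥0∞) (m : ℕ) :
    ∑' K : {K | 2⁻¹ ^ (m + 1) ≤ T.avg F K ∧ T.avg F K ≤ 2⁻¹ ^ m},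
        μ (T.tent K) * T.avg F K ^ s ≤
      2 * (2⁻¹ ^ (s - 1)) ^ m * (T.packingConst * ∫⁻ z in ⋃ K, T.tent K, F z ∂μ) := by
  have hpow : ((2⁻¹ : ℝ≥0∞) ^ m) ^ s = 2 * (2⁻¹ ^ (s - 1)) ^ m * 2⁻¹ ^ (m + 1) := by
    have htwo : (2 : ℝ≥0∞) * 2⁻¹ = 1 := ENNReal.mul_inv_cancel two_ne_zero (by simp)
    calc ((2⁻¹ : ℝ≥0∞) ^ m) ^ s = (2⁻¹ ^ (s - 1) * 2⁻¹) ^ m := by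
          rw [← ENNReal.rpow_natCast, ← ENNReal.rpow_mul, mul_comm, ENNReal.rpow_mul,
            ENNReal.rpow_natCast]
          congr 1
          nth_rw 3 [← ENNReal.rpow_one 2⁻¹]
          rw [← ENNReal.rpow_add _ _ (by simp) (by simp), sub_add_cancel]
      _ = 2 * (2⁻¹ ^ (s - 1)) ^ m * 2⁻¹ ^ (m + 1) := by
          rw [pow_succ, mul_pow]
          calc _ = (2 * 2⁻¹) * ((2⁻¹ : ℝ≥0∞) ^ (s - 1)) ^ m * 2⁻¹ ^ m := by rw [htwo, one_mul]
            _ = _ := by ring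
  calc ∑' K : {K | 2⁻¹ ^ (m + 1) ≤ T.avg F K ∧ T.avg F K ≤ 2⁻¹ ^ m}, μ (T.tent K) * T.avg F K ^ s
      ≤ ∑' K : {K | 2⁻¹ ^ (m + 1) ≤ T.avg F K ∧ T.avg F K ≤ 2⁻¹ ^ m},
          μ (T.tent K) * (2⁻¹ ^ m) ^ s := by
        gcongr with K
        exact K.2.2
    _ ≤ ∑' K : {K | 2⁻¹ ^ (m + 1) ≤ T.avg F K}, μ (T.tent K) * (2⁻¹ ^ m) ^ s :=
        ENNReal.tsum_mono_subtype (fun K => μ (T.tent K) * (2⁻¹ ^ m) ^ s) fun K hK => hK.1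
    _ = 2 * (2⁻¹ ^ (s - 1)) ^ m *
          (2⁻¹ ^ (m + 1) * ∑' K : {K | 2⁻¹ ^ (m + 1) ≤ T.avg F K}, μ (T.tent K)) := by
        rw [ENNReal.tsum_mul_right, hpow]
        ring
    _ ≤ 2 * (2⁻¹ ^ (s - 1)) ^ m * (T.packingConst * ∫⁻ z in ⋃ K, T.tent K, F z ∂μ) := by
        gcongr _ * ?_
        exact T.mul_tsum_measure_le F _

theorem exists_tsum_measure_mul_avg_rpow_le {s : ℝ} (hs : 1 < s) :
    ∃ C : ℝ≥0∞, C ≠ ⊤ ∧ ∀ F : α → ℝ≥0∞,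
      ∑' K : {K | T.avg F K ≤ 1}, μ (T.tent K) * T.avg F K ^ s ≤
        C * ∫⁻ z in ⋃ K, T.tent K, F z ∂μ := by
  set q : ℝ≥0∞ := 2⁻¹ ^ (s - 1)
  have hq : q < 1 := ENNReal.rpow_lt_one (by norm_num) (by linarith)
  refine ⟨2 * (1 - q)⁻¹ * T.packingConst, ?_, fun F => ?_⟩
  · exact ENNReal.mul_ne_top (ENNReal.mul_ne_top (by simp)
      (ENNReal.inv_ne_top.2 (tsub_pos_of_lt hq).ne')) T.packingConst_ne_top
  set φ := fun K => μ (T.tent K) * T.avg F K ^ s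
  set L := fun m : ℕ => {K | 2⁻¹ ^ (m + 1) ≤ T.avg F K ∧ T.avg F K ≤ 2⁻¹ ^ m}
  have hlevel : ∀ K, {K | T.avg F K ≤ 1}.indicator φ K ≤ ∑' m, (L m).indicator φ K := by
    refine fun K => Set.indicator_apply_le' (fun hK => ?_) fun _ => zero_le
    by_cases h0 : T.avg F K = 0
    · simp [φ, h0, show 0 < s by linarith]
    · obtain ⟨m, hm⟩ := exists_two_inv_pow_le h0 hK
      exact (Set.indicator_of_mem (s := L m) hm φ).ge.trans (ENNReal.le_tsum m)
  calc ∑' K : {K | T.avg F K ≤ 1}, φ K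
      ≤ ∑' K, ∑' m, (L m).indicator φ K := by
        rw [tsum_subtype]
        exact ENNReal.tsum_le_tsum hlevel
    _ = ∑' m, ∑' K : L m, φ K := by
        rw [ENNReal.tsum_comm]
        simp_rw [tsum_subtype]
    _ ≤ ∑' m, 2 * q ^ m * (T.packingConst * ∫⁻ z in ⋃ K, T.tent K, F z ∂μ) :=
        ENNReal.tsum_le_tsum fun m => T.tsum_measure_mul_avg_rpow_level_le (by linarith) F m
    _ = 2 * (1 - q)⁻¹ * T.packingConst * ∫⁻ z in ⋃ K, T.tent K, F z ∂μ := by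
        rw [ENNReal.tsum_mul_right, ENNReal.tsum_mul_left, ENNReal.tsum_geometric]
        ring

end TentTree

theorem sq_tsum_mul_le {κ : Type*} (a b : κ → ℝ≥0∞) :
    (∑' i, a i * b i) ^ 2 ≤ (∑' i, a i ^ 2) * ∑' i, b i ^ 2 := by
  let _ : MeasurableSpace κ := ⊤
  have hölder := ENNReal.lintegral_mul_le_Lp_mul_Lq (Measure.count : Measure κ)
    Real.HolderConjugate.two_two (f := a) (g := b) measurable_from_top.aemeasurable
    measurable_from_top.aemeasurable
  simp only [Pi.mul_apply, lintegral_count, ENNReal.rpow_two] at hölder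
  refine (pow_le_pow_left₀ zero_le hölder 2).trans_eq ?_
  rw [mul_pow, ← ENNReal.rpow_two, ← ENNReal.rpow_two, ← ENNReal.rpow_mul, ← ENNReal.rpow_mul]
  norm_num

theorem sq_le_mul_pow_four_add_inv (x : ℝ≥0∞) {a : ℝ≥0∞} : x ^ 2 ≤ a * x ^ 4 + a⁻¹ := by
  rcases le_or_gt (x ^ 2) a⁻¹ with h | h
  · exact h.trans le_add_self
  · have hone : 1 ≤ a * x ^ 2 := by
      rw [mul_comm]
      exact (not_le.1 (ENNReal.le_inv_iff_mul_le.not.1 h.not_ge)).le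
    calc x ^ 2 = 1 * x ^ 2 := (one_mul _).symm
      _ ≤ a * x ^ 2 * x ^ 2 := by gcongr
      _ = a * x ^ 4 := by ring
      _ ≤ a * x ^ 4 + a⁻¹ := le_self_add

theorem setLIntegral_sq_le {α : Type*} [MeasurableSpace α] {μ : Measure α} (s : Set α)
    (B : α → ℝ≥0∞) {c : ℝ≥0∞} (hc : c ≠ ⊤) :
    ∫⁻ z in s, B z ^ 2 ∂μ ≤ c * ∫⁻ z in s, B z ^ 4 ∂μ + c⁻¹ * μ s := by
  calc ∫⁻ z in s, B z ^ 2 ∂μ ≤ ∫⁻ z in s, (c * B z ^ 4 + c⁻¹) ∂μ :=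
        lintegral_mono fun z => sq_le_mul_pow_four_add_inv (B z)
    _ = c * ∫⁻ z in s, B z ^ 4 ∂μ + c⁻¹ * μ s := by
        rw [lintegral_add_right _ measurable_const, lintegral_const_mul' _ _ hc, setLIntegral_const]

theorem sum_range_inv_pow_le {q : ℝ≥0∞} (hq0 : q ≠ 0) (hq1 : q ≤ 1) (k : ℕ) :
    ∑ m ∈ Finset.range k, q⁻¹ ^ m ≤ q⁻¹ ^ k * (1 - q)⁻¹ := by
  have hqtop : q ≠ ⊤ := (hq1.trans_lt ENNReal.one_lt_top).ne
  rw [← Finset.sum_range_reflect, ← ENNReal.tsum_geometric, ← ENNReal.tsum_mul_left]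
  refine (Finset.sum_le_sum fun m hm => ?_).trans (ENNReal.sum_le_tsum (Finset.range k))
  have hmk := Finset.mem_range.1 hm
  calc q⁻¹ ^ (k - 1 - m) ≤ q⁻¹ ^ (k - m) :=
        pow_le_pow_right₀ (ENNReal.one_le_inv.2 hq1) (by omega)
    _ = q⁻¹ ^ (k - m) * (q⁻¹ * q) ^ m := by
        rw [ENNReal.inv_mul_cancel hq0 hqtop, one_pow, mul_one]
    _ = q⁻¹ ^ k * q ^ m := by
        rw [mul_pow, ← mul_assoc, ← pow_add, Nat.sub_add_cancel hmk.le]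

namespace TentTree

variable {α : Type*} [MeasurableSpace α] {ι : ℕ → Type*} {μ : Measure α} (T : TentTree ι μ)

/-- The eighth root of the decay ratio, the base of the weights. -/
noncomputable def root : ℝ≥0∞ := T.ratio ^ (8⁻¹ : ℝ)

/-- The weight `∑ root⁻²ᵐ` over the generations `m` of the tents containing `z`. -/
noncomputable def weight (z : α) : ℝ≥0∞ :=
  ∑' m, (T.layer m).indicator (fun _ => T.root⁻¹ ^ (2 * m)) z

theorem root_ne_zero : T.root ≠ 0 := by
  simp [root, T.ratio_ne_zero]

theorem root_lt_one : T.root < 1 :=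
  ENNReal.rpow_lt_one T.ratio_lt_one (by norm_num)

theorem root_ne_top : T.root ≠ ⊤ :=
  (T.root_lt_one.trans ENNReal.one_lt_top).ne

theorem root_pow_eight_mul (d : ℕ) : T.root ^ (8 * d) = T.ratio ^ d := by
  rw [pow_mul, root, ← ENNReal.rpow_natCast _ 8, ← ENNReal.rpow_mul]
  norm_num

theorem inv_root_pow_mul_root_pow (d : ℕ) : T.root⁻¹ ^ d * T.root ^ d = 1 := by
  rw [← mul_pow, ENNReal.inv_mul_cancel T.root_ne_zero T.root_ne_top, one_pow]

theorem tsum_indicator_eq_weight (z : α) :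
    ∑' K, (T.tent K).indicator (fun _ => T.root⁻¹ ^ (2 * K.1)) z = T.weight z := by
  rw [ENNReal.tsum_sigma', weight]
  refine tsum_congr fun m => ?_
  by_cases hz : z ∈ T.layer m
  · obtain ⟨j, hj⟩ := Set.mem_iUnion.1 hz
    rw [Set.indicator_of_mem hz, tsum_eq_single j, Set.indicator_of_mem hj]
    exact fun i hij => Set.indicator_of_notMem (fun hi => hij (T.eq_of_mem hi hj)) _
  · rw [Set.indicator_of_notMem hz]
    refine ENNReal.tsum_eq_zero.2 fun j => Set.indicator_of_notMem (fun hj => hz ?_) _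
    exact Set.mem_iUnion.2 ⟨j, hj⟩

theorem sq_tsum_indicator_le (x : ((k : ℕ) × ι k) → α → ℝ≥0∞) (z : α) :
    (∑' K, (T.tent K).indicator (x K) z) ^ 2 ≤
      ∑' K, (T.tent K).indicator (fun z => T.root ^ (2 * K.1) * (T.weight z * x K z ^ 2)) z := by
  have hfactor : ∀ K, (T.tent K).indicator (x K) z =
      (T.tent K).indicator (fun _ => T.root⁻¹ ^ K.1) z *
        (T.tent K).indicator (fun z => T.root ^ K.1 * x K z) z := by
    intro K
    by_cases hz : z ∈ T.tent K
    · simp only [Set.indicator_of_mem hz]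
      rw [← mul_assoc, T.inv_root_pow_mul_root_pow, one_mul]
    · simp [hz]
  have hweight : ∑' K, (T.tent K).indicator (fun _ => T.root⁻¹ ^ K.1) z ^ 2 = T.weight z := by
    rw [← T.tsum_indicator_eq_weight]
    refine tsum_congr fun K => ?_
    by_cases hz : z ∈ T.tent K
    · simp only [Set.indicator_of_mem hz]
      rw [← pow_mul, mul_comm]
    · simp [hz]
  rw [tsum_congr hfactor]
  refine (sq_tsum_mul_le _ _).trans_eq ?_
  rw [hweight, ← ENNReal.tsum_mul_left]
  refine tsum_congr fun K => ?_
  by_cases hz : z ∈ T.tent K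
  · simp only [Set.indicator_of_mem hz]
    ring
  · simp [hz]

theorem inv_root_pow_mul_lintegral_sq_le {K : (k : ℕ) × ι k} {M : ℝ≥0∞} {B : α → ℝ≥0∞}
    (hB : ∫⁻ z in T.tent K, B z ^ 4 ∂μ ≤ M * μ (T.tent K)) (d : ℕ) :
    T.root⁻¹ ^ (2 * (K.1 + d)) * ∫⁻ z in T.tent K ∩ T.layer (K.1 + d), B z ^ 2 ∂μ ≤
      T.root⁻¹ ^ (2 * K.1) * ((M + T.bound) * μ (T.tent K)) * (T.root ^ 2) ^ d := by
  have hinv : (T.root ^ (4 * d))⁻¹ * T.root ^ (8 * d) = T.root ^ (4 * d) := by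
    rw [show 8 * d = 4 * d + 4 * d by ring, pow_add, ← mul_assoc, ENNReal.inv_pow,
      T.inv_root_pow_mul_root_pow, one_mul]
  have hpow : T.root⁻¹ ^ (2 * d) * T.root ^ (4 * d) = (T.root ^ 2) ^ d := by
    rw [show 4 * d = 2 * d + 2 * d by ring, pow_add, ← mul_assoc, T.inv_root_pow_mul_root_pow,
      one_mul, pow_mul]
  have hsq : ∫⁻ z in T.tent K ∩ T.layer (K.1 + d), B z ^ 2 ∂μ ≤
      T.root ^ (4 * d) * ((M + T.bound) * μ (T.tent K)) := by
    calc ∫⁻ z in T.tent K ∩ T.layer (K.1 + d), B z ^ 2 ∂μ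
        ≤ T.root ^ (4 * d) * ∫⁻ z in T.tent K ∩ T.layer (K.1 + d), B z ^ 4 ∂μ +
            (T.root ^ (4 * d))⁻¹ * μ (T.tent K ∩ T.layer (K.1 + d)) :=
          setLIntegral_sq_le _ B (ENNReal.pow_ne_top T.root_ne_top)
      _ ≤ T.root ^ (4 * d) * (M * μ (T.tent K)) +
            (T.root ^ (4 * d))⁻¹ * (T.bound * T.root ^ (8 * d) * μ (T.tent K)) := by
          gcongr
          · exact (lintegral_mono_set Set.inter_subset_left).trans hB
          · exact T.root_pow_eight_mul d ▸ T.measure_inter_le K d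
      _ = T.root ^ (4 * d) * (M * μ (T.tent K)) +
            ((T.root ^ (4 * d))⁻¹ * T.root ^ (8 * d)) * (T.bound * μ (T.tent K)) := by ring
      _ = T.root ^ (4 * d) * ((M + T.bound) * μ (T.tent K)) := by rw [hinv]; ring
  calc T.root⁻¹ ^ (2 * (K.1 + d)) * ∫⁻ z in T.tent K ∩ T.layer (K.1 + d), B z ^ 2 ∂μ
      ≤ T.root⁻¹ ^ (2 * (K.1 + d)) * (T.root ^ (4 * d) * ((M + T.bound) * μ (T.tent K))) := by
        gcongr
    _ = T.root⁻¹ ^ (2 * K.1) * ((M + T.bound) * μ (T.tent K)) *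
          (T.root⁻¹ ^ (2 * d) * T.root ^ (4 * d)) := by
        rw [mul_add, pow_add]
        ring
    _ = T.root⁻¹ ^ (2 * K.1) * ((M + T.bound) * μ (T.tent K)) * (T.root ^ 2) ^ d := by rw [hpow]

variable [∀ k, Countable (ι k)]

theorem measurable_weight : Measurable T.weight :=
  Measurable.tsum fun m => measurable_const.indicator (T.measurableSet_layer m)

theorem lintegral_weight_mul (K : (k : ℕ) × ι k) {φ : α → ℝ≥0∞}
    (hφ : AEMeasurable φ (μ.restrict (T.tent K))) :
    ∫⁻ z in T.tent K, T.weight z * φ z ∂μ =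
      ∑' m, T.root⁻¹ ^ (2 * m) * ∫⁻ z in T.tent K ∩ T.layer m, φ z ∂μ := by
  simp_rw [weight, ← ENNReal.tsum_mul_right]
  rw [lintegral_tsum (f := fun m z => (T.layer m).indicator _ z * φ z) fun m =>
    (measurable_const.indicator (T.measurableSet_layer m)).aemeasurable.mul hφ]
  refine tsum_congr fun m => ?_
  rw [Set.inter_comm, ← Measure.restrict_restrict (T.measurableSet_layer m),
    ← lintegral_const_mul' _ _ (ENNReal.pow_ne_top (ENNReal.inv_ne_top.2 T.root_ne_zero)),
    ← lintegral_indicator (T.measurableSet_layer m)]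
  refine lintegral_congr fun z => ?_
  by_cases hz : z ∈ T.layer m <;> simp [hz]

theorem lintegral_weight_mul_sq_le {K : (k : ℕ) × ι k} {M : ℝ≥0∞} {B : α → ℝ≥0∞}
    (hBm : AEMeasurable B (μ.restrict (T.tent K)))
    (hB : ∫⁻ z in T.tent K, B z ^ 4 ∂μ ≤ M * μ (T.tent K)) :
    ∫⁻ z in T.tent K, T.weight z * B z ^ 2 ∂μ ≤
      (2 * M + T.bound + 1) * (1 - T.root ^ 2)⁻¹ * (T.root⁻¹ ^ (2 * K.1) * μ (T.tent K)) := by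
  have hsq : ∫⁻ z in T.tent K, B z ^ 2 ∂μ ≤ (M + 1) * μ (T.tent K) := by
    refine (setLIntegral_sq_le _ B ENNReal.one_ne_top).trans ?_
    rw [one_mul, inv_one, add_mul]
    gcongr
  have hcoarse : ∑ m ∈ Finset.range K.1,
      T.root⁻¹ ^ (2 * m) * ∫⁻ z in T.tent K ∩ T.layer m, B z ^ 2 ∂μ ≤
        T.root⁻¹ ^ (2 * K.1) * (1 - T.root ^ 2)⁻¹ * ((M + 1) * μ (T.tent K)) := by
    calc _ ≤ ∑ m ∈ Finset.range K.1, (T.root ^ 2)⁻¹ ^ m * ((M + 1) * μ (T.tent K)) := by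
          refine Finset.sum_le_sum fun m _ => ?_
          rw [pow_mul, ← ENNReal.inv_pow]
          gcongr
          exact (lintegral_mono_set Set.inter_subset_left).trans hsq
      _ ≤ _ := by
          rw [← Finset.sum_mul, pow_mul, ← ENNReal.inv_pow]
          gcongr
          exact sum_range_inv_pow_le (pow_ne_zero 2 T.root_ne_zero)
            (pow_le_one₀ zero_le T.root_lt_one.le) _
  have hfine : ∑' d, T.root⁻¹ ^ (2 * (d + K.1)) *
      ∫⁻ z in T.tent K ∩ T.layer (d + K.1), B z ^ 2 ∂μ ≤
        T.root⁻¹ ^ (2 * K.1) * ((M + T.bound) * μ (T.tent K)) * (1 - T.root ^ 2)⁻¹ := by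
    rw [← ENNReal.tsum_geometric, ← ENNReal.tsum_mul_left]
    refine ENNReal.tsum_le_tsum fun d => ?_
    rw [add_comm d]
    exact T.inv_root_pow_mul_lintegral_sq_le hB d
  rw [T.lintegral_weight_mul K (hBm.pow_const 2),
    ← ENNReal.summable.sum_add_tsum_nat_add' (k := K.1)]
  exact (add_le_add hcoarse hfine).trans_eq (by ring)

/-- Cauchy–Schwarz with the weights `root⁻²ᵏ`, whose sum over the tents containing a point is
integrable because the tents have thin tops. -/
theorem exists_lintegral_sq_tsum_indicator_le {M : ℝ≥0∞} (hM : M ≠ ⊤) :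
    ∃ C : ℝ≥0∞, C ≠ ⊤ ∧ ∀ (B : ((k : ℕ) × ι k) → α → ℝ≥0∞) (y : ((k : ℕ) × ι k) → ℝ≥0∞),
      (∀ K, AEMeasurable (B K) (μ.restrict (T.tent K))) →
      (∀ K, ∫⁻ z in T.tent K, B K z ^ 4 ∂μ ≤ M * μ (T.tent K)) →
      ∫⁻ z, (∑' K, (T.tent K).indicator (fun z => B K z * y K) z) ^ 2 ∂μ ≤
        C * ∑' K, μ (T.tent K) * y K ^ 2 := by
  refine ⟨(2 * M + T.bound + 1) * (1 - T.root ^ 2)⁻¹, ?_, fun B y hBm hB => ?_⟩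
  · refine ENNReal.mul_ne_top (by simp [ENNReal.mul_eq_top, hM, T.bound_ne_top])
      (ENNReal.inv_ne_top.2 (tsub_pos_of_lt ?_).ne')
    exact pow_lt_one₀ zero_le T.root_lt_one two_ne_zero
  have hmeas : ∀ K, AEMeasurable (fun z => T.weight z * B K z ^ 2) (μ.restrict (T.tent K)) :=
    fun K => T.measurable_weight.aemeasurable.mul ((hBm K).pow_const 2)
  calc ∫⁻ z, (∑' K, (T.tent K).indicator (fun z => B K z * y K) z) ^ 2 ∂μ
      ≤ ∫⁻ z, ∑' K, (T.tent K).indicator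
          (fun z => T.root ^ (2 * K.1) * y K ^ 2 * (T.weight z * B K z ^ 2)) z ∂μ := by
        refine lintegral_mono fun z => (T.sq_tsum_indicator_le _ z).trans_eq ?_
        refine tsum_congr fun K => congrArg (Set.indicator _ · z) (funext fun z => ?_)
        ring
    _ = ∑' K, T.root ^ (2 * K.1) * y K ^ 2 * ∫⁻ z in T.tent K, T.weight z * B K z ^ 2 ∂μ := by
        rw [lintegral_tsum fun K => (aemeasurable_indicator_iff (T.measurableSet_tent K)).2
          ((hmeas K).const_mul _)]
        refine tsum_congr fun K => ?_
        rw [lintegral_indicator (T.measurableSet_tent K), lintegral_const_mul'' _ (hmeas K)]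
    _ ≤ ∑' K, (2 * M + T.bound + 1) * (1 - T.root ^ 2)⁻¹ * (μ (T.tent K) * y K ^ 2) := by
        refine ENNReal.tsum_le_tsum fun K => ?_
        calc _ ≤ T.root ^ (2 * K.1) * y K ^ 2 * ((2 * M + T.bound + 1) * (1 - T.root ^ 2)⁻¹ *
                (T.root⁻¹ ^ (2 * K.1) * μ (T.tent K))) := by
              gcongr
              exact T.lintegral_weight_mul_sq_le (hBm K) (hB K)
          _ = (T.root⁻¹ ^ (2 * K.1) * T.root ^ (2 * K.1)) *
                ((2 * M + T.bound + 1) * (1 - T.root ^ 2)⁻¹ * (μ (T.tent K) * y K ^ 2)) := by ring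
          _ = _ := by rw [T.inv_root_pow_mul_root_pow, one_mul]
    _ = _ := ENNReal.tsum_mul_left

theorem measure_iUnion_one_lt_avg_le (F : α → ℝ≥0∞) :
    μ (⋃ K ∈ {K | 1 < T.avg F K}, T.tent K) ≤
      T.packingConst * ∫⁻ z in ⋃ K, T.tent K, F z ∂μ := by
  calc μ (⋃ K ∈ {K | 1 < T.avg F K}, T.tent K)
      ≤ ∑' K : {K | 1 < T.avg F K}, μ (T.tent K) :=
        measure_biUnion_le μ (Set.to_countable _) _
    _ ≤ ∑' K : {K | 1 ≤ T.avg F K}, μ (T.tent K) :=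
        ENNReal.tsum_mono_subtype (fun K => μ (T.tent K)) fun K hK => le_of_lt (b := T.avg F K) hK
    _ ≤ T.packingConst * ∫⁻ z in ⋃ K, T.tent K, F z ∂μ := by
        simpa only [one_mul] using T.mul_tsum_measure_le F 1

theorem exists_lintegral_sq_tsum_indicator_avg_le_one_le {s : ℝ} (hs : 1 < s) {A M : ℝ≥0∞}
    (hA : A ≠ ⊤) (hM : M ≠ ⊤) :
    ∃ C : ℝ≥0∞, C ≠ ⊤ ∧ ∀ (F : α → ℝ≥0∞) (B : ((k : ℕ) × ι k) → α → ℝ≥0∞)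
      (y : ((k : ℕ) × ι k) → ℝ≥0∞),
      (∀ K, AEMeasurable (B K) (μ.restrict (T.tent K))) →
      (∀ K, ∫⁻ z in T.tent K, B K z ^ 4 ∂μ ≤ M * μ (T.tent K)) →
      (∀ K, T.avg F K ≤ 1 → y K ^ 2 ≤ A * T.avg F K ^ s) →
      ∫⁻ z, (∑' K, (T.tent K).indicator
          (fun z => B K z * {K | T.avg F K ≤ 1}.indicator y K) z) ^ 2 ∂μ ≤
        C * ∫⁻ z in ⋃ K, T.tent K, F z ∂μ := by
  obtain ⟨C₁, hC₁, hL2⟩ := T.exists_lintegral_sq_tsum_indicator_le hM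
  obtain ⟨C₂, hC₂, hcarleson⟩ := T.exists_tsum_measure_mul_avg_rpow_le hs
  refine ⟨C₁ * (A * C₂), ENNReal.mul_ne_top hC₁ (ENNReal.mul_ne_top hA hC₂),
    fun F B y hBm hB hy => (hL2 B _ hBm hB).trans ?_⟩
  calc C₁ * ∑' K, μ (T.tent K) * {K | T.avg F K ≤ 1}.indicator y K ^ 2
      ≤ C₁ * ∑' K, A * {K | T.avg F K ≤ 1}.indicator
          (fun K => μ (T.tent K) * T.avg F K ^ s) K := by
        refine mul_le_mul_right (ENNReal.tsum_le_tsum fun K => ?_) _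
        by_cases hK : K ∈ {K | T.avg F K ≤ 1}
        · simp only [Set.indicator_of_mem hK]
          exact (mul_le_mul_right (hy K hK) _).trans_eq (mul_left_comm _ _ _)
        · simp [Set.indicator_of_notMem hK]
    _ ≤ C₁ * (A * (C₂ * ∫⁻ z in ⋃ K, T.tent K, F z ∂μ)) := by
        rw [ENNReal.tsum_mul_left, ← tsum_subtype]
        gcongr
        exact hcarleson F
    _ = C₁ * (A * C₂) * ∫⁻ z in ⋃ K, T.tent K, F z ∂μ := by ring

/-- Outside the tents on which `F` has average above `1`, only the tents of small average contribute
and the square function estimate applies. -/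
theorem exists_measure_le_tsum_indicator_le {s : ℝ} (hs : 1 < s) {A M κ : ℝ≥0∞} (hA : A ≠ ⊤)
    (hM : M ≠ ⊤) (hκ : κ ≠ 0) (hκtop : κ ≠ ⊤) :
    ∃ C : ℝ≥0∞, C ≠ ⊤ ∧ ∀ (F : α → ℝ≥0∞) (B : ((k : ℕ) × ι k) → α → ℝ≥0∞)
      (y : ((k : ℕ) × ι k) → ℝ≥0∞),
      (∀ K, AEMeasurable (B K) (μ.restrict (T.tent K))) →
      (∀ K, ∫⁻ z in T.tent K, B K z ^ 4 ∂μ ≤ M * μ (T.tent K)) →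
      (∀ K, T.avg F K ≤ 1 → y K ^ 2 ≤ A * T.avg F K ^ s) →
      μ {z | κ ≤ ∑' K, (T.tent K).indicator (fun z => B K z * y K) z} ≤
        C * ∫⁻ z in ⋃ K, T.tent K, F z ∂μ := by
  obtain ⟨C, hC, hL2⟩ := T.exists_lintegral_sq_tsum_indicator_avg_le_one_le hs hA hM
  refine ⟨T.packingConst + C / κ ^ 2, ENNReal.add_ne_top.2 ⟨T.packingConst_ne_top,
    ENNReal.div_ne_top hC (pow_ne_zero 2 hκ)⟩, fun F B y hBm hB hy => ?_⟩
  set S := fun z => ∑' K, (T.tent K).indicator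
    (fun z => B K z * {K | T.avg F K ≤ 1}.indicator y K) z
  have hSm : AEMeasurable S μ := AEMeasurable.tsum fun K =>
    (aemeasurable_indicator_iff (T.measurableSet_tent K)).2 ((hBm K).mul_const _)
  have hsub : {z | κ ≤ ∑' K, (T.tent K).indicator (fun z => B K z * y K) z} ⊆
      (⋃ K ∈ {K | 1 < T.avg F K}, T.tent K) ∪ {z | κ ^ 2 ≤ S z ^ 2} := by
    refine fun z (hz : κ ≤ _) => or_iff_not_imp_left.2 fun hgood => ?_
    refine pow_le_pow_left₀ zero_le (b := S z) (hz.trans_eq (tsum_congr fun K => ?_)) 2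
    by_cases hK : T.avg F K ≤ 1
    · simp [hK]
    · have hzK : z ∉ T.tent K := fun h => hgood (Set.mem_biUnion (not_le.1 hK) h)
      simp [hzK]
  calc _ ≤ μ (⋃ K ∈ {K | 1 < T.avg F K}, T.tent K) + μ {z | κ ^ 2 ≤ S z ^ 2} :=
        (measure_mono hsub).trans (measure_union_le _ _)
    _ ≤ T.packingConst * (∫⁻ z in ⋃ K, T.tent K, F z ∂μ) +
          C * (∫⁻ z in ⋃ K, T.tent K, F z ∂μ) / κ ^ 2 :=
        add_le_add (T.measure_iUnion_one_lt_avg_le F)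
          ((meas_ge_le_lintegral_div (hSm.pow_const 2) (pow_ne_zero 2 hκ)
            (ENNReal.pow_ne_top hκtop)).trans (ENNReal.div_le_div_right (hL2 F B y hBm hB hy) _))
    _ = _ := by rw [add_mul, ENNReal.mul_div_right_comm]

end TentTree

/-! ### Exponential integrability and the Zygmund class -/

/-- The Young function `t (1 + log⁺ t) ^ ε` of the Zygmund space `L (log L) ^ ε`. -/
noncomputable def zygmundFun (ε t : ℝ) : ℝ := t * (1 + Real.posLog t) ^ ε

theorem self_le_zygmundFun {ε t : ℝ} (hε : 0 ≤ ε) (ht : 0 ≤ t) : t ≤ zygmundFun ε t :=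
  le_mul_of_one_le_right ht (Real.one_le_rpow (by linarith [Real.posLog_nonneg (x := t)]) hε)

theorem zygmundFun_nonneg {ε t : ℝ} (ht : 0 ≤ t) : 0 ≤ zygmundFun ε t :=
  mul_nonneg ht (Real.rpow_nonneg (by linarith [Real.posLog_nonneg (x := t)]) ε)

theorem measurable_zygmundFun (ε : ℝ) : Measurable (zygmundFun ε) := by
  unfold zygmundFun
  fun_prop

theorem one_add_le_mul_exp_rpow {ε β : ℝ} (hε : 0 < ε) (hβ : 0 ≤ β) :
    1 + β ≤ (1 + (8 * ε) ^ ε) * Real.exp (β ^ (1 / ε) / 8) := by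
  have hx : 0 ≤ β ^ (1 / ε) := Real.rpow_nonneg hβ _
  have hpow : β ≤ (8 * ε) ^ ε * Real.exp (β ^ (1 / ε) / 8) := by
    have h := ProbabilityTheory.rpow_abs_le_mul_max_exp_of_pos (β ^ (1 / ε)) hε.le
      (show (0 : ℝ) < 1 / 8 by norm_num)
    rw [abs_of_nonneg hx, ← Real.rpow_mul hβ, one_div_mul_cancel hε.ne', Real.rpow_one,
      max_eq_left (Real.exp_le_exp.2 (by linarith))] at h
    convert h using 3 <;> ring
  linarith [Real.one_le_exp (show 0 ≤ β ^ (1 / ε) / 8 by positivity)]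

theorem one_add_pow_four_le {ε β : ℝ} (hε : 0 < ε) (hβ : 0 ≤ β) :
    (1 + β) ^ 4 ≤ (1 + (8 * ε) ^ ε) ^ 4 * Real.exp (β ^ (1 / ε)) := by
  have hx : 0 ≤ β ^ (1 / ε) := Real.rpow_nonneg hβ _
  calc (1 + β) ^ 4 ≤ ((1 + (8 * ε) ^ ε) * Real.exp (β ^ (1 / ε) / 8)) ^ 4 := by
        gcongr; exact one_add_le_mul_exp_rpow hε hβ
    _ = (1 + (8 * ε) ^ ε) ^ 4 * Real.exp (4 * (β ^ (1 / ε) / 8)) := by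
        rw [mul_pow, ← Real.exp_nat_mul, Nat.cast_ofNat]
    _ ≤ (1 + (8 * ε) ^ ε) ^ 4 * Real.exp (β ^ (1 / ε)) := by gcongr; linarith

theorem one_add_mul_le_of_rpow_le {ε β g : ℝ} (hε : 0 < ε) (hβ : 0 ≤ β) (hg : 0 ≤ g)
    (h : β ^ (1 / ε) ≤ 8 * Real.posLog g) : (1 + β) * g ≤ (1 + 8 ^ ε) * zygmundFun ε g := by
  have hlog : 0 ≤ Real.posLog g := Real.posLog_nonneg
  have hβ' : β ≤ 8 ^ ε * (1 + Real.posLog g) ^ ε := by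
    calc β = (β ^ (1 / ε)) ^ ε := by
          rw [← Real.rpow_mul hβ, one_div_mul_cancel hε.ne', Real.rpow_one]
      _ ≤ (8 * (1 + Real.posLog g)) ^ ε := by gcongr; linarith
      _ = 8 ^ ε * (1 + Real.posLog g) ^ ε := Real.mul_rpow (by norm_num) (by linarith)
  calc (1 + β) * g = g + β * g := by ring
    _ ≤ zygmundFun ε g + 8 ^ ε * (1 + Real.posLog g) ^ ε * g := by
        gcongr; exact self_le_zygmundFun hε.le hg
    _ = (1 + 8 ^ ε) * zygmundFun ε g := by rw [zygmundFun]; ring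

theorem mul_min_one_le {E g σ : ℝ} (hE : 0 ≤ E) (hg : 0 ≤ g) (hσ : 0 < σ) :
    E * min g 1 ≤ σ⁻¹ * g + σ ^ 3 * E ^ 4 := by
  rcases le_total E σ⁻¹ with h | h
  · calc E * min g 1 ≤ σ⁻¹ * g := by gcongr; exact min_le_left _ _
      _ ≤ σ⁻¹ * g + σ ^ 3 * E ^ 4 := le_add_of_nonneg_right (by positivity)
  · calc E * min g 1 ≤ E * 1 := by gcongr; exact min_le_right _ _
      _ ≤ E * (σ * E) ^ 3 := by
          gcongr
          exact one_le_pow₀ ((inv_le_iff_one_le_mul₀' hσ).1 h)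
      _ = σ ^ 3 * E ^ 4 := by ring
      _ ≤ σ⁻¹ * g + σ ^ 3 * E ^ 4 := le_add_of_nonneg_left (by positivity)

theorem one_add_mul_le_of_lt_rpow {ε β g σ : ℝ} (hε : 0 < ε) (hβ : 0 ≤ β) (hg : 0 ≤ g)
    (hσ : 0 < σ) (h : 8 * Real.posLog g < β ^ (1 / ε)) :
    (1 + β) * g ≤ (1 + (8 * ε) ^ ε) * (σ⁻¹ * g + σ ^ 3 * Real.exp (β ^ (1 / ε))) := by
  set x := β ^ (1 / ε)
  have hg_le : g ≤ Real.exp (x / 8) * min g 1 := by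
    rcases le_total g 1 with h1 | h1
    · rw [min_eq_left h1]
      exact le_mul_of_one_le_left hg (Real.one_le_exp (div_nonneg (Real.rpow_nonneg hβ _)
        (by norm_num)))
    · rw [Real.posLog_eq_log (by rwa [abs_of_nonneg hg])] at h
      rw [min_eq_right h1, mul_one, ← Real.log_le_iff_le_exp (by linarith)]
      linarith
  calc (1 + β) * g
      ≤ ((1 + (8 * ε) ^ ε) * Real.exp (x / 8)) * (Real.exp (x / 8) * min g 1) := by
        gcongr; exact one_add_le_mul_exp_rpow hε hβ
    _ = (1 + (8 * ε) ^ ε) * (Real.exp (x / 8) ^ 2 * min g 1) := by ring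
    _ ≤ (1 + (8 * ε) ^ ε) * (σ⁻¹ * g + σ ^ 3 * (Real.exp (x / 8) ^ 2) ^ 4) := by
        gcongr; exact mul_min_one_le (by positivity) hg hσ
    _ = (1 + (8 * ε) ^ ε) * (σ⁻¹ * g + σ ^ 3 * Real.exp x) := by
        rw [← pow_mul, ← Real.exp_nat_mul]; norm_num [mul_div_cancel₀]

theorem exists_young_zygmundFun_exp {ε : ℝ} (hε : 0 < ε) : ∃ A : ℝ, 0 < A ∧ ∀ β g σ : ℝ, 0 ≤ β →
    0 ≤ g → 0 < σ → σ ≤ 1 →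
    (1 + β) * g ≤ A * (σ⁻¹ * zygmundFun ε g + σ ^ 3 * Real.exp (β ^ (1 / ε))) := by
  refine ⟨max (1 + 8 ^ ε) (1 + (8 * ε) ^ ε), by positivity, fun β g σ hβ hg hσ hσ1 => ?_⟩
  have hZ : 0 ≤ zygmundFun ε g := zygmundFun_nonneg hg
  rcases le_or_gt (β ^ (1 / ε)) (8 * Real.posLog g) with h | h
  · calc (1 + β) * g ≤ (1 + 8 ^ ε) * (1 * zygmundFun ε g + 0) := by
          rw [one_mul, add_zero]; exact one_add_mul_le_of_rpow_le hε hβ hg h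
      _ ≤ _ := by
          gcongr
          · exact le_max_left _ _
          · exact (one_le_inv₀ hσ).2 hσ1
          · positivity
  · refine (one_add_mul_le_of_lt_rpow hε hβ hg hσ h).trans ?_
    gcongr
    · exact le_max_right _ _
    · exact self_le_zygmundFun hε.le hg

theorem exists_young_zygmundFun_exp_ennreal {ε : ℝ} (hε : 0 < ε) : ∃ A : ℝ≥0∞, A ≠ ⊤ ∧
    ∀ (β g : ℝ) (σ : ℝ≥0∞), 0 ≤ β → 0 ≤ g → σ ≤ 1 → ENNReal.ofReal ((1 + β) * g) ≤
      A * (σ⁻¹ * ENNReal.ofReal (zygmundFun ε g) +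
        σ ^ 3 * ENNReal.ofReal (Real.exp (β ^ (1 / ε)))) := by
  obtain ⟨A, hA, hyoung⟩ := exists_young_zygmundFun_exp hε
  refine ⟨ENNReal.ofReal A, ENNReal.ofReal_ne_top, fun β g σ hβ hg hσ => ?_⟩
  rcases hg.eq_or_lt with rfl | hg0
  · simp
  have hZ : 0 < zygmundFun ε g := hg0.trans_le (self_le_zygmundFun hε.le hg)
  rcases eq_or_ne σ 0 with rfl | hσ0
  · simp [ENNReal.top_mul, ENNReal.mul_top, hA, hZ]
  lift σ to NNReal using hσ.trans_lt ENNReal.one_lt_top |>.ne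
  have hσpos : (0 : ℝ) < σ := by exact_mod_cast pos_iff_ne_zero.2 hσ0
  refine (ENNReal.ofReal_le_ofReal
    (hyoung β g σ hβ hg hσpos (by exact_mod_cast hσ))).trans_eq ?_
  rw [ENNReal.ofReal_mul hA.le, ENNReal.ofReal_add (by positivity) (by positivity),
    ENNReal.ofReal_mul (by positivity), ENNReal.ofReal_mul (by positivity),
    ENNReal.ofReal_inv_of_pos hσpos, ENNReal.ofReal_pow hσpos.le, ENNReal.ofReal_coe_nnreal]

theorem inv_rpow_fourth_mul_self {x : ℝ≥0∞} (hx : x ≠ ⊤) :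
    (x ^ (1 / 4 : ℝ))⁻¹ * x = (x ^ (1 / 4 : ℝ)) ^ 3 := by
  rcases eq_or_ne x 0 with rfl | hx0
  · simp
  nth_rw 2 [← ENNReal.rpow_one x]
  rw [← ENNReal.rpow_neg, ← ENNReal.rpow_add _ _ hx0 hx, ← ENNReal.rpow_natCast,
    ← ENNReal.rpow_mul]
  norm_num

namespace TentTree

variable {α : Type*} [MeasurableSpace α] {ι : ℕ → Type*} {μ : Measure α} (T : TentTree ι μ)

/-- The sparse operator that dominates a commutator: on the tent `K` it is `1 + β K` times the
average of `(1 + β K) g`. For a symbol `b`, the function `β K` is the normalized oscillation of `b`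
about its mean over `K`. -/
noncomputable def oscSparse (β : ((k : ℕ) × ι k) → α → ℝ) (g : α → ℝ) (z : α) : ℝ≥0∞ :=
  ∑' K, (T.tent K).indicator (fun z => ENNReal.ofReal (1 + β K z) *
    T.avg (fun w => ENNReal.ofReal ((1 + β K w) * g w)) K) z

theorem avg_const_mul {F : α → ℝ≥0∞} {c : ℝ≥0∞} {K : (k : ℕ) × ι k}
    (hF : AEMeasurable F (μ.restrict (T.tent K))) :
    T.avg (fun z => c * F z) K = c * T.avg F K := by
  rw [avg, avg, lintegral_const_mul'' _ hF]
  ring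

theorem avg_add {F G : α → ℝ≥0∞} {K : (k : ℕ) × ι k}
    (hF : AEMeasurable F (μ.restrict (T.tent K))) :
    T.avg (fun z => F z + G z) K = T.avg F K + T.avg G K := by
  rw [avg, avg, avg, lintegral_add_left' hF, mul_add]

theorem avg_mono {F G : α → ℝ≥0∞} (h : ∀ z, F z ≤ G z) (K : (k : ℕ) × ι k) :
    T.avg F K ≤ T.avg G K := by
  unfold avg
  gcongr
  exact h _

theorem avg_le_mul_bound {F : α → ℝ≥0∞} {M : ℝ≥0∞} {K : (k : ℕ) × ι k}
    (h : ∫⁻ z in T.tent K, F z ∂μ ≤ M * μ (T.tent K)) : T.avg F K ≤ M * T.bound := by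
  rw [avg, ENNReal.inv_mul_le_iff (T.size_ne_zero K) (T.size_ne_top K)]
  calc ∫⁻ z in T.tent K, F z ∂μ ≤ M * (T.bound * T.size K) :=
        h.trans (by gcongr; exact T.measure_le K)
    _ = T.size K * (M * T.bound) := by ring

/-- The parameter of Young's inequality is taken to be the fourth root of the average of
`zygmundFun ε ∘ g`. -/
theorem exists_avg_one_add_mul_sq_le {ε : ℝ} (hε : 0 < ε) {M : ℝ≥0∞} (hM : M ≠ ⊤) :
    ∃ A : ℝ≥0∞, A ≠ ⊤ ∧ ∀ (K : (k : ℕ) × ι k) (β g : α → ℝ), (∀ z, 0 ≤ β z) → (∀ z, 0 ≤ g z) →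
      AEMeasurable β (μ.restrict (T.tent K)) → AEMeasurable g (μ.restrict (T.tent K)) →
      ∫⁻ z in T.tent K, ENNReal.ofReal (Real.exp (β z ^ (1 / ε))) ∂μ ≤ M * μ (T.tent K) →
      T.avg (fun z => ENNReal.ofReal (zygmundFun ε (g z))) K ≤ 1 →
      T.avg (fun z => ENNReal.ofReal ((1 + β z) * g z)) K ^ 2 ≤
        A * T.avg (fun z => ENNReal.ofReal (zygmundFun ε (g z))) K ^ (3 / 2 : ℝ) := by
  obtain ⟨A, hA, hyoung⟩ := exists_young_zygmundFun_exp_ennreal hε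
  refine ⟨(A * (1 + M * T.bound)) ^ 2, ENNReal.pow_ne_top (ENNReal.mul_ne_top hA
    (ENNReal.add_ne_top.2 ⟨ENNReal.one_ne_top, ENNReal.mul_ne_top hM T.bound_ne_top⟩)),
    fun K β g hβ hg hβm hgm hexp havg => ?_⟩
  set F : α → ℝ≥0∞ := fun z => ENNReal.ofReal (zygmundFun ε (g z))
  set E : α → ℝ≥0∞ := fun z => ENNReal.ofReal (Real.exp (β z ^ (1 / ε)))
  set σ : ℝ≥0∞ := T.avg F K ^ (1 / 4 : ℝ)
  have hFm : AEMeasurable F (μ.restrict (T.tent K)) :=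
    ((measurable_zygmundFun ε).comp_aemeasurable hgm).ennreal_ofReal
  have hEm : AEMeasurable E (μ.restrict (T.tent K)) :=
    (Real.measurable_exp.comp_aemeasurable (hβm.pow_const _)).ennreal_ofReal
  have hsum : AEMeasurable (fun z => σ⁻¹ * F z + σ ^ 3 * E z) (μ.restrict (T.tent K)) :=
    (hFm.const_mul _).add (hEm.const_mul _)
  have hlin : T.avg (fun z => ENNReal.ofReal ((1 + β z) * g z)) K ≤
      A * (1 + M * T.bound) * σ ^ 3 := by
    calc T.avg (fun z => ENNReal.ofReal ((1 + β z) * g z)) K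
        ≤ T.avg (fun z => A * (σ⁻¹ * F z + σ ^ 3 * E z)) K := T.avg_mono (fun z =>
          hyoung _ _ σ (hβ z) (hg z) (ENNReal.rpow_le_one havg (by norm_num))) K
      _ = A * (σ⁻¹ * T.avg F K + σ ^ 3 * T.avg E K) := by
          rw [T.avg_const_mul hsum, T.avg_add (hFm.const_mul _), T.avg_const_mul hFm,
            T.avg_const_mul hEm]
      _ ≤ A * (σ ^ 3 + σ ^ 3 * (M * T.bound)) := by
          rw [inv_rpow_fourth_mul_self (havg.trans_lt ENNReal.one_lt_top).ne]
          gcongr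
          exact T.avg_le_mul_bound hexp
      _ = A * (1 + M * T.bound) * σ ^ 3 := by ring
  refine (pow_le_pow_left' hlin 2).trans_eq ?_
  rw [mul_pow, ← pow_mul, ← ENNReal.rpow_natCast (T.avg F K ^ _), ← ENNReal.rpow_mul]
  norm_num

theorem exists_measure_le_oscSparse_le [∀ k, Countable (ι k)] {ε : ℝ} (hε : 0 < ε) {M κ : ℝ≥0∞}
    (hM : M ≠ ⊤) (hκ : κ ≠ 0) (hκ_top : κ ≠ ⊤) :
    ∃ C : ℝ≥0∞, C ≠ ⊤ ∧ ∀ (β : ((k : ℕ) × ι k) → α → ℝ) (g : α → ℝ), (∀ K z, 0 ≤ β K z) →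
      (∀ z, 0 ≤ g z) → (∀ K, AEMeasurable (β K) (μ.restrict (T.tent K))) →
      (∀ K, AEMeasurable g (μ.restrict (T.tent K))) →
      (∀ K, ∫⁻ z in T.tent K, ENNReal.ofReal (Real.exp (β K z ^ (1 / ε))) ∂μ ≤
        M * μ (T.tent K)) →
      μ {z | κ ≤ T.oscSparse β g z} ≤
        C * ∫⁻ z in ⋃ K, T.tent K, ENNReal.ofReal (zygmundFun ε (g z)) ∂μ := by
  obtain ⟨A, hA, havg⟩ := T.exists_avg_one_add_mul_sq_le hε hM
  set B : ℝ := (1 + (8 * ε) ^ ε) ^ 4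
  have hB0 : 0 ≤ B := by positivity
  obtain ⟨C, hC, hweak⟩ := T.exists_measure_le_tsum_indicator_le (s := 3 / 2) (by norm_num) hA
    (M := ENNReal.ofReal B * M) (ENNReal.mul_ne_top ENNReal.ofReal_ne_top hM) hκ hκ_top
  refine ⟨C, hC, fun β g hβ hg hβm hgm hexp => hweak _ _ _
    (fun K => ((hβm K).const_add 1).ennreal_ofReal) (fun K => ?_)
    fun K => havg K (β K) g (hβ K) hg (hβm K) (hgm K) (hexp K)⟩
  calc ∫⁻ z in T.tent K, ENNReal.ofReal (1 + β K z) ^ 4 ∂μ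
      ≤ ∫⁻ z in T.tent K, ENNReal.ofReal B * ENNReal.ofReal (Real.exp (β K z ^ (1 / ε))) ∂μ := by
        refine lintegral_mono fun z => ?_
        rw [← ENNReal.ofReal_pow (by linarith [hβ K z]), ← ENNReal.ofReal_mul hB0]
        exact ENNReal.ofReal_le_ofReal (one_add_pow_four_le hε (hβ K z))
    _ = ENNReal.ofReal B * ∫⁻ z in T.tent K, ENNReal.ofReal (Real.exp (β K z ^ (1 / ε))) ∂μ :=
        lintegral_const_mul' _ _ ENNReal.ofReal_ne_top
    _ ≤ ENNReal.ofReal B * M * μ (T.tent K) := by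
        rw [mul_assoc]; gcongr; exact hexp K

end TentTree

namespace TentTree

variable {α : Type*} [MeasurableSpace α] {ι : ℕ → Type*} {μ : Measure α} (T : TentTree ι μ)

/-- The integral kernel of `oscSparse β`. -/
noncomputable def oscKernel (β : ((k : ℕ) × ι k) → α → ℝ) (z w : α) : ℝ≥0∞ :=
  ∑' K, (T.tent K).indicator (fun z => ENNReal.ofReal (1 + β K z) * (T.size K)⁻¹) z *
    (T.tent K).indicator (fun w => ENNReal.ofReal (1 + β K w)) w

variable {T} {β : ((k : ℕ) × ι k) → α → ℝ} {g : α → ℝ} {z : α}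

theorem le_oscKernel {K : (k : ℕ) × ι k} {w : α} (hz : z ∈ T.tent K) (hw : w ∈ T.tent K) :
    ENNReal.ofReal (1 + β K z) * (T.size K)⁻¹ * ENNReal.ofReal (1 + β K w) ≤
      T.oscKernel β z w := by
  refine le_trans (le_of_eq ?_) (ENNReal.le_tsum K)
  rw [Set.indicator_of_mem hz, Set.indicator_of_mem hw]

theorem aemeasurable_oscKernel [∀ k, Countable (ι k)]
    (hβ : ∀ K, AEMeasurable (β K) (μ.restrict (T.tent K))) (z : α) :
    AEMeasurable (T.oscKernel β z) μ :=
  AEMeasurable.tsum fun K => ((aemeasurable_indicator_iff (T.measurableSet_tent K)).2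
    ((hβ K).const_add 1).ennreal_ofReal).const_mul _

theorem oscSparse_eq_lintegral [∀ k, Countable (ι k)] (hβ_nonneg : ∀ K z, 0 ≤ β K z)
    (hβ : ∀ K, AEMeasurable (β K) (μ.restrict (T.tent K)))
    (hg : ∀ K, AEMeasurable g (μ.restrict (T.tent K))) :
    T.oscSparse β g z = ∫⁻ w, T.oscKernel β z w * ENNReal.ofReal (g w) ∂μ := by
  have hmul : ∀ K w, ENNReal.ofReal (1 + β K w) * ENNReal.ofReal (g w) =
      ENNReal.ofReal ((1 + β K w) * g w) := fun K w =>
    (ENNReal.ofReal_mul (by linarith [hβ_nonneg K w])).symm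
  have hmeas : ∀ K, AEMeasurable ((T.tent K).indicator
      fun w => ENNReal.ofReal ((1 + β K w) * g w)) μ := fun K =>
    (aemeasurable_indicator_iff (T.measurableSet_tent K)).2
      (((hβ K).const_add 1).mul (hg K)).ennreal_ofReal
  have hkernel : ∀ w, T.oscKernel β z w * ENNReal.ofReal (g w) =
      ∑' K, (T.tent K).indicator (fun z => ENNReal.ofReal (1 + β K z) * (T.size K)⁻¹) z *
        (T.tent K).indicator (fun w => ENNReal.ofReal ((1 + β K w) * g w)) w := fun w => by
    simp only [oscKernel, ← ENNReal.tsum_mul_right, mul_assoc, ← hmul, Set.indicator_mul_left]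
  simp only [hkernel]
  rw [lintegral_tsum fun K => (hmeas K).const_mul _]
  refine tsum_congr fun K => ?_
  rw [lintegral_const_mul'' _ (hmeas K), lintegral_indicator (T.measurableSet_tent K)]
  simp only [avg, ← mul_assoc, Set.indicator_mul_const]

theorem oscSparse_const_mul {t : ℝ} (ht : 0 ≤ t) :
    T.oscSparse β (fun w => t * g w) z = ENNReal.ofReal t * T.oscSparse β g z := by
  have havg : ∀ K, T.avg (fun w => ENNReal.ofReal ((1 + β K w) * (t * g w))) K =
      ENNReal.ofReal t * T.avg (fun w => ENNReal.ofReal ((1 + β K w) * g w)) K := fun K => by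
    simp only [avg, mul_left_comm _ t, ENNReal.ofReal_mul ht]
    rw [lintegral_const_mul' _ _ ENNReal.ofReal_ne_top, mul_left_comm]
  simp only [oscSparse, havg, ← ENNReal.tsum_mul_left, mul_left_comm _ (ENNReal.ofReal t),
    Set.indicator_const_mul]

end TentTree

namespace SphereDyadicSystem

variable {n : ℕ} {θ₀ : ℝ} (Q : SphereDyadicSystem n (Real.exp (-2 * θ₀)))

/-- The dyadic Carleson tents of a dyadic system, normalized by the order of magnitude
`δ ^ (k (n + 1))` of their volumes. -/
noncomputable def tentTree (hn : 1 ≤ n) (hθ : 0 < θ₀) :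
    TentTree (fun k => Fin (Q.card k)) (volume : Measure (Cn n)) where
  tent := Q.tent θ₀
  size K := ENNReal.ofReal (Real.exp (-2 * θ₀) ^ (K.1 * (n + 1)))
  ratio := ENNReal.ofReal (Real.exp (-2 * θ₀))
  bound := (Q.exists_volume_tent_le hn hθ).choose + ENNReal.ofReal (4 * n)
  size_ne_zero K := (ENNReal.ofReal_pos.2 (by positivity)).ne'
  size_ne_top K := ENNReal.ofReal_ne_top
  ratio_ne_zero := (ENNReal.ofReal_pos.2 (Real.exp_pos _)).ne'
  ratio_lt_one := by rw [ENNReal.ofReal_lt_one, Real.exp_lt_one_iff]; linarith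
  bound_ne_top := ENNReal.add_ne_top.2
    ⟨(Q.exists_volume_tent_le hn hθ).choose_spec.1, ENNReal.ofReal_ne_top⟩
  measurableSet_tent := Q.measurableSet_tent hn (Real.exp_pos _) hθ
  nested h hJ hK := Q.tent_subset_tent hn (Real.exp_pos _) hθ h hJ hK
  eq_of_mem := Q.eq_of_mem_tent hn (Real.exp_pos _) hθ
  measure_inter_le K d := by
    have hsub : ⋃ j, Q.tent θ₀ ⟨K.1 + d, j⟩ ⊆ {z | Real.tanh ((K.1 + d : ℕ) * θ₀) ≤ ‖z‖} :=
      Set.iUnion_subset fun j z hz => ((Q.mem_tent_iff hn (Real.exp_pos _) hθ _ z).1 hz).2.1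
    refine (measure_mono (Set.inter_subset_inter_right _ hsub)).trans
      ((Q.volume_tent_inter_le hn hθ K d).trans ?_)
    rw [ENNReal.ofReal_mul (by positivity), ENNReal.ofReal_pow (Real.exp_pos _).le]
    gcongr
    exact le_add_self
  measure_le K := ((Q.exists_volume_tent_le hn hθ).choose_spec.2 K).trans
    (by gcongr; exact le_self_add)

end SphereDyadicSystem

/-! ### Sparse domination of the commutator -/

theorem integrableOn_div_one_sub_inner_pow {n : ℕ} {h : Cn n → ℂ}
    (hh : IntegrableOn h (unitBall n)) {z : Cn n} (hz : z ∈ unitBall n) (k : ℕ) :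
    IntegrableOn (fun w => h w / (1 - inner ℂ w z) ^ k) (unitBall n) := by
  rw [mem_unitBall_iff] at hz
  have hcont : Continuous fun w : Cn n => (1 - inner ℂ w z : ℂ) ^ k := by fun_prop
  have hbound : ∀ w ∈ unitBall n, ‖((1 - inner ℂ w z : ℂ) ^ k)⁻¹‖ ≤ ((1 - ‖z‖) ^ k)⁻¹ := by
    intro w hw
    rw [mem_unitBall_iff] at hw
    have hle : 1 - ‖z‖ ≤ ‖(1 : ℂ) - inner ℂ w z‖ :=
      le_trans (by nlinarith [norm_nonneg z]) (one_sub_norm_mul_norm_le z w)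
    have : 0 < 1 - ‖z‖ := by linarith
    rw [norm_inv, norm_pow]
    gcongr
  exact hh.mul_bdd hcont.measurable.inv.aestronglyMeasurable
    ((ae_restrict_iff' measurableSet_ball).2 (.of_forall hbound))

theorem commutator_eq {n : ℕ} {g f : Cn n → ℂ} (hf : IntegrableOn f (unitBall n))
    (hgf : IntegrableOn (fun w => g w * f w) (unitBall n)) {z : Cn n} (hz : z ∈ unitBall n) :
    commutator n g f z = ((n.factorial : ℂ) / (Real.pi : ℂ) ^ n) *
      ∫ w in unitBall n, (g z - g w) * f w / (1 - inner ℂ w z) ^ (n + 1) := by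
  have hsplit : ∀ w, (g z - g w) * f w / (1 - inner ℂ w z) ^ (n + 1) =
      g z * (f w / (1 - inner ℂ w z) ^ (n + 1)) - g w * f w / (1 - inner ℂ w z) ^ (n + 1) :=
    fun w => by ring
  simp only [hsplit]
  rw [integral_sub ((integrableOn_div_one_sub_inner_pow hf hz _).const_mul _)
    (integrableOn_div_one_sub_inner_pow hgf hz _), integral_const_mul, commutator, bergmanProj,
    bergmanProj]
  ring

theorem norm_sub_le_mul_one_add_mul_one_add {E : Type*} [SeminormedAddCommGroup E] {c : ℝ}
    (hc : 0 < c) (a b m : E) : ‖a - b‖ ≤ c * ((1 + ‖a - m‖ / c) * (1 + ‖b - m‖ / c)) := by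
  calc ‖a - b‖ ≤ ‖a - m‖ + ‖b - m‖ := by
        rw [norm_sub_rev b]; exact norm_sub_le_norm_sub_add_norm_sub a m b
    _ = c * (‖a - m‖ / c + ‖b - m‖ / c) := by field_simp
    _ ≤ c * ((1 + ‖a - m‖ / c) * (1 + ‖b - m‖ / c)) := by
        have h : 0 ≤ 1 + ‖a - m‖ / c * (‖b - m‖ / c) := by positivity
        gcongr
        linarith

namespace DyadicFamily

variable {n : ℕ} {θ₀ : ℝ}

theorem exists_enorm_div_le_sum_oscKernel (hn : 1 ≤ n) (hθ : 0 < θ₀) (D : DyadicFamily n θ₀) :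
    ∃ C : ℝ, 0 < C ∧ ∀ (g : Cn n → ℂ) (m : ∀ ℓ, (D.system ℓ).Kube → ℂ) (c : ℝ), 0 < c →
      ∀ z ∈ unitBall n, ∀ w ∈ unitBall n,
        ‖(g z - g w) / (1 - inner ℂ w z) ^ (n + 1)‖ₑ ≤ ENNReal.ofReal (C * c) *
          ∑ ℓ, ((D.system ℓ).tentTree hn hθ).oscKernel (fun K w => ‖g w - m ℓ K‖ / c) z w := by
  obtain ⟨C, hC, htent⟩ := D.exists_tent_mem_mem hn hθ
  refine ⟨C ^ (n + 1), by positivity, fun g m c hc z hz w hw => ?_⟩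
  obtain ⟨ℓ, K, hzK, hwK, hK⟩ := htent z hz w hw
  set τ : ℝ := Real.exp (-2 * θ₀) ^ (K.1 * (n + 1))
  have hτ : 0 < τ := by positivity
  have hτ_le : τ ≤ C ^ (n + 1) * ‖(1 : ℂ) - inner ℂ w z‖ ^ (n + 1) := by
    rw [← mul_pow]
    exact (pow_mul _ _ _).trans_le (by gcongr)
  have hreal : ‖(g z - g w) / (1 - inner ℂ w z) ^ (n + 1)‖ ≤
      C ^ (n + 1) * c * ((1 + ‖g z - m ℓ K‖ / c) * τ⁻¹ * (1 + ‖g w - m ℓ K‖ / c)) := by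
    have hinv : (‖(1 : ℂ) - inner ℂ w z‖ ^ (n + 1))⁻¹ ≤ C ^ (n + 1) * τ⁻¹ := by
      have hpos : 0 < ‖(1 : ℂ) - inner ℂ w z‖ ^ (n + 1) :=
        pos_of_mul_pos_right (hτ.trans_le hτ_le) (by positivity)
      rw [inv_le_iff_one_le_mul₀ hpos, mul_right_comm, ← div_eq_mul_inv, one_le_div hτ]
      exact hτ_le
    rw [norm_div, norm_pow, div_eq_mul_inv]
    calc ‖g z - g w‖ * (‖(1 : ℂ) - inner ℂ w z‖ ^ (n + 1))⁻¹
        ≤ (c * ((1 + ‖g z - m ℓ K‖ / c) * (1 + ‖g w - m ℓ K‖ / c))) * (C ^ (n + 1) * τ⁻¹) := by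
          gcongr; exact norm_sub_le_mul_one_add_mul_one_add hc _ _ _
      _ = _ := by ring
  calc ‖(g z - g w) / (1 - inner ℂ w z) ^ (n + 1)‖ₑ
      ≤ ENNReal.ofReal (C ^ (n + 1) * c) * (ENNReal.ofReal (1 + ‖g z - m ℓ K‖ / c) *
          (ENNReal.ofReal τ)⁻¹ * ENNReal.ofReal (1 + ‖g w - m ℓ K‖ / c)) := by
        rw [← ofReal_norm, ← ENNReal.ofReal_inv_of_pos hτ, ← ENNReal.ofReal_mul (by positivity),
          ← ENNReal.ofReal_mul (by positivity), ← ENNReal.ofReal_mul (by positivity)]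
        exact ENNReal.ofReal_le_ofReal hreal
    _ ≤ _ := by
        gcongr
        exact (TentTree.le_oscKernel (T := (D.system ℓ).tentTree hn hθ) hzK hwK).trans
          (Finset.single_le_sum (f := fun ℓ => ((D.system ℓ).tentTree hn hθ).oscKernel
            (fun K w => ‖g w - m ℓ K‖ / c) z w) (fun _ _ => zero_le) (Finset.mem_univ ℓ))

theorem exists_enorm_commutator_le_sum_oscSparse (hn : 1 ≤ n) (hθ : 0 < θ₀)
    (D : DyadicFamily n θ₀) : ∃ C : ℝ, 0 < C ∧ ∀ (g f : Cn n → ℂ)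
      (m : ∀ ℓ, (D.system ℓ).Kube → ℂ) (c : ℝ), 0 < c →
      AEStronglyMeasurable g (volume.restrict (unitBall n)) →
      IntegrableOn f (unitBall n) → IntegrableOn (fun w => g w * f w) (unitBall n) →
      ∀ z ∈ unitBall n, ‖commutator n g f z‖ₑ ≤ ENNReal.ofReal (C * c) *
        ∑ ℓ, ((D.system ℓ).tentTree hn hθ).oscSparse (fun K w => ‖g w - m ℓ K‖ / c)
          (fun w => ‖f w‖) z := by
  obtain ⟨C, hC, hkernel⟩ := D.exists_enorm_div_le_sum_oscKernel hn hθ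
  set a : ℝ := n.factorial / Real.pi ^ n
  have ha : ‖((n.factorial : ℂ) / (Real.pi : ℂ) ^ n)‖ₑ = ENNReal.ofReal a := by
    rw [← ofReal_norm, norm_div, norm_pow, Complex.norm_natCast, Complex.norm_real,
      Real.norm_of_nonneg Real.pi_pos.le]
  refine ⟨a * C, by positivity, fun g f m c hc hg hf hgf z hz => ?_⟩
  set k : _ → Cn n → ℝ≥0∞ := fun ℓ =>
    ((D.system ℓ).tentTree hn hθ).oscKernel (fun K w => ‖g w - m ℓ K‖ / c) z
  have hβ : ∀ ℓ K, AEMeasurable (fun w => ‖g w - m ℓ K‖ / c)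
      (volume.restrict (((D.system ℓ).tentTree hn hθ).tent K)) := fun ℓ K =>
    ((hg.sub (aestronglyMeasurable_const (b := m ℓ K))).mono_set
      ((D.system ℓ).tent_subset_unitBall K)).norm.aemeasurable.div_const c
  have hf_tent : ∀ ℓ K, AEMeasurable (fun w => ‖f w‖)
      (volume.restrict (((D.system ℓ).tentTree hn hθ).tent K)) := fun ℓ K =>
    (hf.mono_set ((D.system ℓ).tent_subset_unitBall K)).norm.aemeasurable
  have hkm : ∀ ℓ, AEMeasurable (fun w => k ℓ w * ENNReal.ofReal ‖f w‖)
      (volume.restrict (unitBall n)) := fun ℓ =>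
    (TentTree.aemeasurable_oscKernel (hβ ℓ) z).restrict.mul hf.norm.aemeasurable.ennreal_ofReal
  have hpointwise : ∀ w ∈ unitBall n, ‖(g z - g w) * f w / (1 - inner ℂ w z) ^ (n + 1)‖ₑ ≤
      ENNReal.ofReal (C * c) * ∑ ℓ, k ℓ w * ENNReal.ofReal ‖f w‖ := fun w hw => by
    rw [mul_div_right_comm, enorm_mul, ← Finset.sum_mul, ← mul_assoc, ofReal_norm]
    gcongr
    exact hkernel g m c hc z hz w hw
  rw [commutator_eq hf hgf hz, enorm_mul, ha, mul_assoc a, ENNReal.ofReal_mul (by positivity),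
    mul_assoc]
  gcongr
  calc _ ≤ ∫⁻ w in unitBall n, ‖(g z - g w) * f w / (1 - inner ℂ w z) ^ (n + 1)‖ₑ :=
        enorm_integral_le_lintegral_enorm _
    _ ≤ ∫⁻ w in unitBall n, ENNReal.ofReal (C * c) * ∑ ℓ, k ℓ w * ENNReal.ofReal ‖f w‖ :=
        setLIntegral_mono_ae' measurableSet_ball (.of_forall hpointwise)
    _ = ENNReal.ofReal (C * c) * ∑ ℓ, ∫⁻ w in unitBall n, k ℓ w * ENNReal.ofReal ‖f w‖ := by
        rw [lintegral_const_mul' _ _ ENNReal.ofReal_ne_top, lintegral_finsetSum' _ fun ℓ _ => hkm ℓ]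
    _ ≤ _ := by
        gcongr with ℓ
        rw [TentTree.oscSparse_eq_lintegral (fun _ _ => by positivity) (hβ ℓ) (hf_tent ℓ)]
        exact setLIntegral_le_lintegral _ _

end DyadicFamily

/-! ### The oscillation norm and the weak-type estimate -/

section Integrability

variable {α : Type*} [MeasurableSpace α] {μ : Measure α} {ε c t : ℝ}

theorem integrable_mul_of_lintegral_exp_ne_top {g f : α → ℂ} {m : ℂ} (hε : 0 < ε) (hc : 0 < c)
    (ht : 0 < t) (hg : AEStronglyMeasurable g μ) (hf : Integrable f μ)
    (hexp : ∫⁻ w, ENNReal.ofReal (Real.exp ((‖g w - m‖ / c) ^ (1 / ε))) ∂μ ≠ ⊤)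
    (hzyg : ∫⁻ w, ENNReal.ofReal (zygmundFun ε (t * ‖f w‖)) ∂μ ≠ ⊤) :
    Integrable (fun w => g w * f w) μ := by
  obtain ⟨A, _, hyoung⟩ := exists_young_zygmundFun_exp hε
  have hbound : ∀ w, ‖(g w - m) * f w‖ ≤ c / t * A *
      (zygmundFun ε (t * ‖f w‖) + Real.exp ((‖g w - m‖ / c) ^ (1 / ε))) := fun w => by
    have h := hyoung (‖g w - m‖ / c) (t * ‖f w‖) 1 (by positivity) (by positivity) one_pos le_rfl
    rw [inv_one, one_mul, one_pow, one_mul] at h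
    calc ‖(g w - m) * f w‖ = c / t * (‖g w - m‖ / c * (t * ‖f w‖)) := by
          rw [norm_mul]; field_simp
      _ ≤ c / t * ((1 + ‖g w - m‖ / c) * (t * ‖f w‖)) := by gcongr; linarith
      _ ≤ _ := by rw [mul_assoc]; gcongr
  have hzyg_int : Integrable (fun w => zygmundFun ε (t * ‖f w‖)) μ :=
    (lintegral_ofReal_ne_top_iff_integrable ((measurable_zygmundFun ε).comp_aemeasurable
      (hf.aemeasurable.norm.const_mul t)).aestronglyMeasurable
      (.of_forall fun w => zygmundFun_nonneg (by positivity))).1 hzyg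
  have hexp_int : Integrable (fun w => Real.exp ((‖g w - m‖ / c) ^ (1 / ε))) μ :=
    (lintegral_ofReal_ne_top_iff_integrable
      ((((hg.sub aestronglyMeasurable_const).norm.aemeasurable.div_const c).pow_const _).exp
        ).aestronglyMeasurable (.of_forall fun w => (Real.exp_pos _).le)).1 hexp
  have hsub : Integrable (fun w => (g w - m) * f w) μ :=
    ((hzyg_int.add hexp_int).const_mul _).mono'
      ((hg.sub aestronglyMeasurable_const).mul hf.aestronglyMeasurable) (.of_forall hbound)
  refine (hsub.add (hf.const_mul m)).congr (.of_forall fun w => ?_)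
  simp only [Pi.add_apply, sub_mul, sub_add_cancel]

theorem lintegral_enorm_sub_le_lintegral_exp {E : Type*} [SeminormedAddCommGroup E] (hε : 0 < ε)
    (hc : 0 < c) (g : α → E) (m : E) :
    ∫⁻ w, ‖g w - m‖ₑ ∂μ ≤ ENNReal.ofReal ((1 + (8 * ε) ^ ε) * c) *
      ∫⁻ w, ENNReal.ofReal (Real.exp ((‖g w - m‖ / c) ^ (1 / ε))) ∂μ := by
  rw [← lintegral_const_mul' _ _ ENNReal.ofReal_ne_top]
  refine lintegral_mono fun w => ?_
  rw [← ofReal_norm, ← ENNReal.ofReal_mul (by positivity)]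
  refine ENNReal.ofReal_le_ofReal ?_
  have hβ : 0 ≤ ‖g w - m‖ / c := by positivity
  calc ‖g w - m‖ = c * (‖g w - m‖ / c) := by field_simp
    _ ≤ c * (1 + ‖g w - m‖ / c) := by gcongr; linarith
    _ ≤ c * ((1 + (8 * ε) ^ ε) * Real.exp ((‖g w - m‖ / c) ^ (1 / ε) / 8)) := by
        gcongr; exact one_add_le_mul_exp_rpow hε hβ
    _ ≤ c * ((1 + (8 * ε) ^ ε) * Real.exp ((‖g w - m‖ / c) ^ (1 / ε))) := by
        gcongr; exact div_le_self (by positivity) (by norm_num)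
    _ = _ := by ring

theorem lintegral_zygmundFun_div_mul_norm {E : Type*} [SeminormedAddCommGroup E] (hc : 0 ≤ c)
    (lam : ℝ) (f : α → E) :
    ∫⁻ z, ENNReal.ofReal (zygmundFun ε (c / lam * ‖f z‖)) ∂μ = ENNReal.ofReal c *
      ∫⁻ z, ENNReal.ofReal (‖f z‖ / lam * (1 + Real.posLog (‖f z‖ * c / lam)) ^ ε) ∂μ := by
  rw [← lintegral_const_mul' _ _ ENNReal.ofReal_ne_top]
  refine lintegral_congr fun z => ?_
  rw [← ENNReal.ofReal_mul hc, zygmundFun, show c / lam * ‖f z‖ = ‖f z‖ * c / lam by ring]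
  congr 1
  ring

end Integrability

section ConstantSymbol

variable {n : ℕ} {g : Cn n → ℂ} {m : ℂ}

theorem commutator_eq_zero_of_ae_eq_const (hg : g =ᵐ[volume.restrict (unitBall n)] fun _ => m)
    (f : Cn n → ℂ) {z : Cn n} (hz : g z = m) : commutator n g f z = 0 := by
  have hint : ∫ w in unitBall n, g w * f w / (1 - inner ℂ w z) ^ (n + 1) =
      m * ∫ w in unitBall n, f w / (1 - inner ℂ w z) ^ (n + 1) := by
    rw [← integral_const_mul]
    refine integral_congr_ae (hg.mono fun w hw => ?_)
    simp only [hw, mul_div_assoc]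
  rw [commutator, bergmanProj, bergmanProj, hint, hz]
  ring

theorem volume_lt_norm_commutator_eq_zero
    (hg : g =ᵐ[volume.restrict (unitBall n)] fun _ => m) (f : Cn n → ℂ) {lam : ℝ}
    (hlam : 0 ≤ lam) : volume {z | z ∈ unitBall n ∧ lam < ‖commutator n g f z‖} = 0 := by
  rw [measure_eq_zero_iff_ae_notMem]
  filter_upwards [(ae_restrict_iff' measurableSet_ball).1 hg] with z hz ⟨hz_ball, hlt⟩
  rw [commutator_eq_zero_of_ae_eq_const hg f (hz hz_ball), norm_zero] at hlt
  exact hlt.not_ge hlam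

end ConstantSymbol

section OscNorm

variable {n : ℕ} {θ₀ : ℝ} {D : DyadicFamily n θ₀} {b : Cn n → ℂ} {r c : ℝ} {M : ℝ≥0∞}

theorem expOscSup_le_iff : expOscSup D b r c ≤ M ↔ ∀ ℓ K,
    ∫⁻ w in (D.system ℓ).tent θ₀ K,
      ENNReal.ofReal (Real.exp ((‖b w - ⨍ u in (D.system ℓ).tent θ₀ K, b u‖ / c) ^ r)) ≤
        M * volume ((D.system ℓ).tent θ₀ K) := by
  simp only [expOscSup, iSup_le_iff]
  refine forall₂_congr fun ℓ K => ?_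
  have htop : volume ((D.system ℓ).tent θ₀ K) ≠ ⊤ :=
    ((measure_mono ((D.system ℓ).tent_subset_unitBall K)).trans_lt measure_ball_lt_top).ne
  by_cases h0 : volume ((D.system ℓ).tent θ₀ K) = 0
  · simp [Measure.restrict_eq_zero.2 h0]
  · rw [ENNReal.inv_mul_le_iff h0 htop, mul_comm M]

theorem exp_div_mul_rpow_le {x t : ℝ} (hr : 0 < r) (hx : 0 ≤ x) (ht : 1 ≤ t) :
    Real.exp ((x / t ^ (1 / r)) ^ r) ≤ t⁻¹ * Real.exp (x ^ r) + 1 := by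
  have ht_pos : 0 < t := one_pos.trans_le ht
  have hpow : (x / t ^ (1 / r)) ^ r = x ^ r * t⁻¹ := by
    rw [Real.div_rpow hx (by positivity), ← Real.rpow_mul ht_pos.le, one_div_mul_cancel hr.ne',
      Real.rpow_one, div_eq_mul_inv]
  have hbernoulli := rpow_one_add_le_one_add_mul_self
    (s := Real.exp (x ^ r) - 1) (by linarith [Real.exp_pos (x ^ r)])
    (p := t⁻¹) (by positivity) (inv_le_one_of_one_le₀ ht)
  rw [add_sub_cancel] at hbernoulli
  rw [hpow, Real.exp_mul]
  linarith [inv_pos.2 ht_pos]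

theorem MemOsc.exists_expOscSup_le_two (hr : 0 < r) (hb : MemOsc D r b) :
    ∃ c : ℝ, 0 < c ∧ expOscSup D b r c ≤ 2 := by
  obtain ⟨-, c, hc, hlt⟩ := hb
  set t : ℝ := max 1 (expOscSup D b r c).toReal
  have ht : 1 ≤ t := le_max_left _ _
  have ht_pos : 0 < t := one_pos.trans_le ht
  have hle : expOscSup D b r c ≤ ENNReal.ofReal t := by
    rw [← ENNReal.ofReal_toReal hlt.ne]
    exact ENNReal.ofReal_le_ofReal (le_max_right _ _)
  refine ⟨c * t ^ (1 / r), by positivity, expOscSup_le_iff.2 fun ℓ K => ?_⟩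
  set T := (D.system ℓ).tent θ₀ K
  set m := ⨍ u in T, b u
  calc ∫⁻ w in T, ENNReal.ofReal (Real.exp ((‖b w - m‖ / (c * t ^ (1 / r))) ^ r))
      ≤ ∫⁻ w in T, (ENNReal.ofReal t⁻¹ * ENNReal.ofReal (Real.exp ((‖b w - m‖ / c) ^ r)) + 1) := by
        refine lintegral_mono fun w => ?_
        rw [← ENNReal.ofReal_mul (by positivity), ← ENNReal.ofReal_one,
          ← ENNReal.ofReal_add (by positivity) zero_le_one, ← div_div]
        exact ENNReal.ofReal_le_ofReal (exp_div_mul_rpow_le hr (by positivity) ht)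
    _ = ENNReal.ofReal t⁻¹ * (∫⁻ w in T, ENNReal.ofReal (Real.exp ((‖b w - m‖ / c) ^ r))) +
          volume T := by
        rw [lintegral_add_right _ measurable_const, lintegral_const_mul' _ _ ENNReal.ofReal_ne_top,
          lintegral_one, Measure.restrict_apply_univ]
    _ ≤ ENNReal.ofReal t⁻¹ * (ENNReal.ofReal t * volume T) + volume T := by
        gcongr; exact expOscSup_le_iff.1 hle ℓ K
    _ = 2 * volume T := by
        rw [← mul_assoc, ← ENNReal.ofReal_mul (by positivity), inv_mul_cancel₀ ht_pos.ne',
          ENNReal.ofReal_one, one_mul, two_mul]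

theorem oscNorm_nonneg (D : DyadicFamily n θ₀) (r : ℝ) (b : Cn n → ℂ) : 0 ≤ oscNorm D r b :=
  Real.sInf_nonneg fun _ hc => hc.1.le

theorem MemOsc.exists_seq_tendsto_oscNorm (hr : 0 < r) (hb : MemOsc D r b) :
    ∃ s : ℕ → ℝ, Filter.Tendsto s Filter.atTop (nhds (oscNorm D r b)) ∧
      ∀ k, 0 < s k ∧ expOscSup D b r (s k) ≤ 2 := by
  obtain ⟨s, -, hs, hmem⟩ := exists_seq_tendsto_sInf
    (show {c : ℝ | 0 < c ∧ expOscSup D b r c ≤ 2}.Nonempty from hb.exists_expOscSup_le_two hr)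
    ⟨0, fun _ hc => hc.1.le⟩
  exact ⟨s, hs, hmem⟩

theorem expOscSup_le_of_tendsto {s : ℕ → ℝ} (hr : 0 ≤ r) (hc : c ≠ 0)
    (hb : AEStronglyMeasurable b (volume.restrict (unitBall n)))
    (hs : Filter.Tendsto s Filter.atTop (nhds c)) (hle : ∀ k, expOscSup D b r (s k) ≤ M) :
    expOscSup D b r c ≤ M := by
  refine expOscSup_le_iff.2 fun ℓ K => ?_
  set T := (D.system ℓ).tent θ₀ K
  set m := ⨍ u in T, b u
  set F : ℝ → Cn n → ℝ≥0∞ := fun a w => ENNReal.ofReal (Real.exp ((‖b w - m‖ / a) ^ r))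
  have hF : ∀ a, AEMeasurable (F a) (volume.restrict T) := fun a =>
    ((((hb.sub (aestronglyMeasurable_const (b := m))).mono_set
      ((D.system ℓ).tent_subset_unitBall K)).norm.aemeasurable.div_const a).pow_const r
        ).exp.ennreal_ofReal
  have hlim : ∀ w, Filter.Tendsto (fun k => F (s k) w) Filter.atTop (nhds (F c w)) := fun w =>
    ENNReal.tendsto_ofReal (((tendsto_const_nhds.div hs hc).rpow_const (.inr hr)).rexp)
  calc ∫⁻ w in T, F c w = ∫⁻ w in T, Filter.liminf (fun k => F (s k) w) Filter.atTop := by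
        simp only [fun w => (hlim w).liminf_eq]
    _ ≤ Filter.liminf (fun k => ∫⁻ w in T, F (s k) w) Filter.atTop :=
        lintegral_liminf_le' fun k => hF (s k)
    _ ≤ M * volume T := Filter.liminf_le_of_frequently_le'
        (.of_forall fun k => expOscSup_le_iff.1 (hle k) ℓ K)

theorem MemOsc.expOscSup_oscNorm_le_two (hr : 0 < r) (hb : MemOsc D r b)
    (hpos : 0 < oscNorm D r b) : expOscSup D b r (oscNorm D r b) ≤ 2 := by
  obtain ⟨s, hs, hmem⟩ := hb.exists_seq_tendsto_oscNorm hr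
  exact expOscSup_le_of_tendsto hr.le hpos.ne' hb.1.aestronglyMeasurable hs fun k => (hmem k).2

theorem DyadicFamily.exists_tent_eq_unitBall (hn : 1 ≤ n) (hθ : 0 < θ₀) (D : DyadicFamily n θ₀) :
    ∃ ℓ K, (D.system ℓ).tent θ₀ K = unitBall n := by
  obtain ⟨ζ, hζ⟩ := unitSphere_nonempty hn
  obtain ⟨A, hA, happrox⟩ := D.approx
  obtain ⟨ℓ, -⟩ := happrox ζ hζ A⁻¹ (inv_pos.2 hA) (mul_inv_cancel₀ hA.ne').le
  obtain ⟨j, -⟩ := (D.system ℓ).exists_mem_cube 0 hζ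
  exact ⟨ℓ, ⟨0, j⟩, (D.system ℓ).tent_zero hn (Real.exp_pos _) hθ j⟩

theorem MemOsc.exists_ae_eq_const_of_oscNorm_eq_zero {ε : ℝ} (hn : 1 ≤ n) (hθ : 0 < θ₀)
    (hε : 0 < ε) (hb : MemOsc D (1 / ε) b) (hzero : oscNorm D (1 / ε) b = 0) :
    ∃ m, b =ᵐ[volume.restrict (unitBall n)] fun _ => m := by
  obtain ⟨ℓ, K, hK⟩ := D.exists_tent_eq_unitBall hn hθ
  set m := ⨍ u in unitBall n, b u
  set I := ∫⁻ w in unitBall n, ‖b w - m‖ₑ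
  obtain ⟨s, hs, hmem⟩ := hb.exists_seq_tendsto_oscNorm (by positivity)
  have hI : ∀ k, I ≤ ENNReal.ofReal ((1 + (8 * ε) ^ ε) * s k) * (2 * volume (unitBall n)) := by
    intro k
    have hexp := expOscSup_le_iff.1 (hmem k).2 ℓ K
    rw [hK] at hexp
    exact (lintegral_enorm_sub_le_lintegral_exp hε (hmem k).1 b m).trans (by gcongr)
  have hlim : Filter.Tendsto
      (fun k => ENNReal.ofReal ((1 + (8 * ε) ^ ε) * s k) * (2 * volume (unitBall n)))
      Filter.atTop (nhds 0) := by
    have h := ENNReal.Tendsto.mul_const (ENNReal.tendsto_ofReal (hs.const_mul (1 + (8 * ε) ^ ε)))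
      (.inr (ENNReal.mul_ne_top ENNReal.ofNat_ne_top measure_ball_lt_top.ne) :
        _ ∨ 2 * volume (unitBall n) ≠ ⊤)
    rwa [hzero, mul_zero, ENNReal.ofReal_zero, zero_mul] at h
  have hI_zero : I = 0 := nonpos_iff_eq_zero.1 (ge_of_tendsto' hlim hI)
  refine ⟨m, ?_⟩
  filter_upwards [(lintegral_eq_zero_iff' (hb.1.aestronglyMeasurable.sub
    aestronglyMeasurable_const).enorm).1 hI_zero] with w hw
  exact sub_eq_zero.1 (enorm_eq_zero.1 hw)

end OscNorm

theorem exists_ofReal_le_of_lt_mul_sum {ι : Type*} [Fintype ι] {A lam : ℝ} (hA : 0 < A)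
    (hlam : 0 ≤ lam) {S : ι → ℝ≥0∞}
    (h : ENNReal.ofReal lam < ENNReal.ofReal (A * lam) * ∑ i, S i) :
    ∃ i, ENNReal.ofReal (1 / (A * (Fintype.card ι + 1))) ≤ S i := by
  by_contra! hlt
  refine h.not_ge ?_
  calc ENNReal.ofReal (A * lam) * ∑ i, S i
      ≤ ENNReal.ofReal (A * lam) * ∑ _i : ι, ENNReal.ofReal (1 / (A * (Fintype.card ι + 1))) := by
        gcongr with i
        exact (hlt i).le
    _ = ENNReal.ofReal (lam * (Fintype.card ι / (Fintype.card ι + 1))) := by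
        rw [Finset.sum_const, Finset.card_univ, nsmul_eq_mul, ← ENNReal.ofReal_natCast,
          ← ENNReal.ofReal_mul (by positivity), ← ENNReal.ofReal_mul (by positivity)]
        congr 1
        field_simp
    _ ≤ ENNReal.ofReal lam := ENNReal.ofReal_le_ofReal
        (mul_le_of_le_one_right hlam (div_le_one_of_le₀ (by linarith) (by positivity)))

namespace DyadicFamily

variable {n : ℕ} {θ₀ ε : ℝ}

theorem exists_volume_lt_norm_commutator_le (hn : 1 ≤ n) (hθ : 0 < θ₀) (D : DyadicFamily n θ₀)
    (hε : 0 < ε) {M : ℝ≥0∞} (hM : M ≠ ⊤) :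
    ∃ C : ℝ≥0∞, C ≠ ⊤ ∧ ∀ (g f : Cn n → ℂ) (m : ∀ ℓ, (D.system ℓ).Kube → ℂ) (c lam : ℝ),
      0 < c → 0 < lam → AEStronglyMeasurable g (volume.restrict (unitBall n)) →
      IntegrableOn f (unitBall n) → IntegrableOn (fun w => g w * f w) (unitBall n) →
      (∀ ℓ K, ∫⁻ w in (D.system ℓ).tent θ₀ K,
        ENNReal.ofReal (Real.exp ((‖g w - m ℓ K‖ / c) ^ (1 / ε))) ≤
          M * volume ((D.system ℓ).tent θ₀ K)) →
      volume {z | z ∈ unitBall n ∧ lam < ‖commutator n g f z‖} ≤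
        C * ∫⁻ z in unitBall n, ENNReal.ofReal (zygmundFun ε (c / lam * ‖f z‖)) := by
  obtain ⟨A, hA, hdom⟩ := D.exists_enorm_commutator_le_sum_oscSparse hn hθ
  set κ : ℝ≥0∞ := ENNReal.ofReal (1 / (A * (Fintype.card (Fin D.N) + 1)))
  have hκ : κ ≠ 0 := (ENNReal.ofReal_pos.2 (by positivity)).ne'
  choose C hC hweak using fun ℓ => ((D.system ℓ).tentTree hn hθ).exists_measure_le_oscSparse_le
    hε hM hκ ENNReal.ofReal_ne_top
  refine ⟨∑ ℓ, C ℓ, ENNReal.sum_ne_top.2 fun ℓ _ => hC ℓ,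
    fun g f m c lam hc hlam hg hf hgf hosc => ?_⟩
  set S : Fin D.N → Cn n → ℝ≥0∞ := fun ℓ => ((D.system ℓ).tentTree hn hθ).oscSparse
    (fun K w => ‖g w - m ℓ K‖ / c) (fun w => c / lam * ‖f w‖) with hS
  have hle : ∀ z ∈ unitBall n, ‖commutator n g f z‖ₑ ≤ ENNReal.ofReal (A * lam) * ∑ ℓ, S ℓ z := by
    intro z hz
    simp only [hS, TentTree.oscSparse_const_mul (div_pos hc hlam).le]
    rw [← Finset.mul_sum, ← mul_assoc, ← ENNReal.ofReal_mul (by positivity),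
      show A * lam * (c / lam) = A * c by field_simp]
    exact hdom g f m c hc hg hf hgf z hz
  have hsub : {z | z ∈ unitBall n ∧ lam < ‖commutator n g f z‖} ⊆ ⋃ ℓ, {z | κ ≤ S ℓ z} := by
    rintro z ⟨hz, hlt⟩
    rw [← ENNReal.ofReal_lt_ofReal_iff_of_nonneg hlam.le, ofReal_norm] at hlt
    exact Set.mem_iUnion.2 (exists_ofReal_le_of_lt_mul_sum hA hlam.le (hlt.trans_le (hle z hz)))
  have hmeas : ∀ ℓ K, AEMeasurable (fun w => ‖g w - m ℓ K‖ / c)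
      (volume.restrict ((D.system ℓ).tent θ₀ K)) := fun ℓ K =>
    ((hg.sub (aestronglyMeasurable_const (b := m ℓ K))).mono_set
      ((D.system ℓ).tent_subset_unitBall K)).norm.aemeasurable.div_const c
  calc volume {z | z ∈ unitBall n ∧ lam < ‖commutator n g f z‖}
      ≤ ∑ ℓ, volume {z | κ ≤ S ℓ z} := (measure_mono hsub).trans (measure_iUnion_fintype_le _ _)
    _ ≤ ∑ ℓ, C ℓ * ∫⁻ z in unitBall n, ENNReal.ofReal (zygmundFun ε (c / lam * ‖f z‖)) := by
        refine Finset.sum_le_sum fun ℓ _ => (hweak ℓ _ _ (fun _ _ => by positivity)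
          (fun _ => by positivity) (hmeas ℓ) (fun K => (hf.mono_set
            ((D.system ℓ).tent_subset_unitBall K)).norm.aemeasurable.const_mul _)
          (hosc ℓ)).trans ?_
        gcongr
        exact Set.iUnion_subset (D.system ℓ).tent_subset_unitBall
    _ = _ := (Finset.sum_mul _ _ _).symm

theorem exists_volume_lt_norm_commutator_conj_le (hn : 1 ≤ n) (hθ : 0 < θ₀)
    (D : DyadicFamily n θ₀) (hε : 0 < ε) :
    ∃ C : ℝ, 0 < C ∧ ∀ (b f : Cn n → ℂ) (c lam : ℝ), 0 < c → 0 < lam →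
      AEStronglyMeasurable b (volume.restrict (unitBall n)) → expOscSup D b (1 / ε) c ≤ 2 →
      IntegrableOn f (unitBall n) →
      volume {z | z ∈ unitBall n ∧
          lam < ‖commutator n (fun w => (starRingEnd ℂ) (b w)) f z‖} ≤
        ENNReal.ofReal (C * c) * ∫⁻ z in unitBall n, ENNReal.ofReal (‖f z‖ / lam *
          (1 + Real.posLog (‖f z‖ * c / lam)) ^ ε) := by
  obtain ⟨C, hC, hweak⟩ := D.exists_volume_lt_norm_commutator_le hn hθ hε
    (ENNReal.ofNat_ne_top (n := 2))
  refine ⟨C.toReal + 1, by positivity, fun b f c lam hc hlam hb hosc hf => ?_⟩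
  set I := ∫⁻ z in unitBall n, ENNReal.ofReal (‖f z‖ / lam *
    (1 + Real.posLog (‖f z‖ * c / lam)) ^ ε)
  set g : Cn n → ℂ := fun w => (starRingEnd ℂ) (b w)
  set m : ∀ ℓ, (D.system ℓ).Kube → ℂ := fun ℓ K =>
    (starRingEnd ℂ) (⨍ u in (D.system ℓ).tent θ₀ K, b u)
  have hzyg := lintegral_zygmundFun_div_mul_norm (μ := volume.restrict (unitBall n)) (ε := ε)
    hc.le lam f
  have hg : AEStronglyMeasurable g (volume.restrict (unitBall n)) :=
    RCLike.continuous_conj.comp_aestronglyMeasurable hb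
  have hexp : ∀ ℓ K, ∫⁻ w in (D.system ℓ).tent θ₀ K,
      ENNReal.ofReal (Real.exp ((‖g w - m ℓ K‖ / c) ^ (1 / ε))) ≤
        2 * volume ((D.system ℓ).tent θ₀ K) := by
    simpa only [g, m, ← map_sub, RCLike.norm_conj] using expOscSup_le_iff.1 hosc
  rcases eq_or_ne I ⊤ with hI | hI
  · rw [hI, ENNReal.mul_top (ENNReal.ofReal_pos.2 (by positivity)).ne']
    exact le_top
  obtain ⟨ℓ, K, hK⟩ := D.exists_tent_eq_unitBall hn hθ
  have hgf : IntegrableOn (fun w => g w * f w) (unitBall n) := by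
    refine integrable_mul_of_lintegral_exp_ne_top (m := m ℓ K) hε hc (div_pos hc hlam) hg hf
      (ne_top_of_le_ne_top ?_ (hK ▸ hexp ℓ K))
      (hzyg ▸ ENNReal.mul_ne_top ENNReal.ofReal_ne_top hI)
    exact ENNReal.mul_ne_top ENNReal.ofNat_ne_top measure_ball_lt_top.ne
  calc volume {z | z ∈ unitBall n ∧ lam < ‖commutator n g f z‖}
      ≤ C * (ENNReal.ofReal c * I) := hzyg ▸ hweak g f m c lam hc hlam hg hf hgf hexp
    _ ≤ ENNReal.ofReal (C.toReal + 1) * (ENNReal.ofReal c * I) := by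
        gcongr
        rw [← ENNReal.ofReal_toReal hC]
        exact ENNReal.ofReal_le_ofReal (by simp)
    _ = ENNReal.ofReal ((C.toReal + 1) * c) * I := by
        rw [← mul_assoc, ← ENNReal.ofReal_mul (by positivity)]

end DyadicFamily

end BergmanCommutator

open BergmanCommutator in
theorem theoremE_general (n : ℕ) (hn : 1 ≤ n) (θ₀ : ℝ) (hθ₀ : 0 < θ₀) (D : DyadicFamily n θ₀)
    (ε : ℝ) (hε : 0 < ε) :
    ∃ C : ℝ, 0 < C ∧ ∀ b : Cn n → ℂ, MemOsc D (1 / ε) b →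
      ∀ f : Cn n → ℂ, IntegrableOn f (unitBall n) → ∀ lam : ℝ, 0 < lam →
        volume {z | z ∈ unitBall n ∧
            lam < ‖commutator n (fun w => (starRingEnd ℂ) (b w)) f z‖} ≤
          ENNReal.ofReal (C * oscNorm D (1 / ε) b) *
            ∫⁻ z in unitBall n, ENNReal.ofReal (‖f z‖ / lam *
              (1 + Real.posLog (‖f z‖ * oscNorm D (1 / ε) b / lam)) ^ ε) := by
  obtain ⟨C, hC, hweak⟩ := D.exists_volume_lt_norm_commutator_conj_le hn hθ₀ hε
  refine ⟨C, hC, fun b hb f hf lam hlam => ?_⟩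
  rcases (oscNorm_nonneg D (1 / ε) b).eq_or_lt with hzero | hpos
  · obtain ⟨m, hm⟩ := hb.exists_ae_eq_const_of_oscNorm_eq_zero hn hθ₀ hε hzero.symm
    exact (volume_lt_norm_commutator_eq_zero (hm.fun_comp (starRingEnd ℂ)) f hlam.le).trans_le
      zero_le
  · exact hweak b f _ lam hpos hlam hb.1.aestronglyMeasurable
      (hb.expOscSup_oscNorm_le_two (by positivity) hpos) hf

open BergmanCommutator in
theorem theoremE (n : ℕ) (hn : 1 ≤ n) (θ₀ : ℝ) (hθ₀ : 0 < θ₀) (D : DyadicFamily n θ₀)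
    (ε : ℝ) (hε : 0 < ε) (hε1 : ε ≤ 1) :
    ∃ C : ℝ, 0 < C ∧ ∀ b : Cn n → ℂ, MemOsc D (1 / ε) b →
      ∀ f : Cn n → ℂ, AEStronglyMeasurable f (volume.restrict (unitBall n)) →
        (∃ M : ℝ, ∀ z, ‖f z‖ ≤ M) → HasCompactSupport f → tsupport f ⊆ unitBall n →
        ∀ lam : ℝ, 0 < lam →
          volume {z | z ∈ unitBall n ∧
              lam < ‖commutator n (fun w => (starRingEnd ℂ) (b w)) f z‖} ≤
            ENNReal.ofReal (C * oscNorm D (1 / ε) b) *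
              ∫⁻ z in unitBall n, ENNReal.ofReal (‖f z‖ / lam *
                (1 + Real.posLog (‖f z‖ * oscNorm D (1 / ε) b / lam)) ^ ε) := by
  obtain ⟨C, hC, hweak⟩ := theoremE_general n hn θ₀ hθ₀ D ε hε
  exact ⟨C, hC, fun b hb f hf ⟨M, hM⟩ _ _ => hweak b hb f
    (IntegrableOn.of_bound measure_ball_lt_top hf M (.of_forall hM))⟩
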